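/- Let $d\ge 2$ and let $\Omega\subset\mathbb R^d$ be a bounded Lipschitz domain with connected complement. Let $L^\infty_+(\Omega)$ be the set of $\sigma\in L^\infty(\Omega;\mathbb R)$ with $\sigma\ge a$ a.e. for some constant $a>0$, and let $L^2_\diamond(\partial\Omega)$ be the space of complex-valued $f\in L^2(\partial\Omega)$ that are orthogonal to the constants; $(\cdot,\cdot)$ is the $L^2(\partial\Omega)$ inner product, linear in its first argument. For $\sigma\in L^\infty_+(\Omega)$ the Neumann-to-Dirichlet operator $\varLambda(\sigma)\in\mathcal L(L^2_\diamond(\partial\Omega))$ maps $f$ to the mean-free trace $u|_{\partial\Omega}$ of a solution $u\in H^1(\Omega)$ of $$\int_\Omega \sigma\nabla u\cdot\nabla\overline v\,dx=(f,v|_{\partial\Omega})\qquad\text{for all } v\in H^1(\Omega);$$ it is well defined, and $\varLambda$ is Fréchet differentiable on $L^\infty_+(\Omega)$, with derivative at $\sigma$ in the direction $\eta\in L^\infty(\Omega;\mathbb R)$ denoted by $D\varLambda(\sigma;\eta)$. Let $\psi_1,\dots,\psi_n\in L^2_\diamond(\partial\Omega)$ be orthonormal and independent of $\sigma$, let $P^{(n)}$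 be the orthogonal projection of $L^2_\diamond(\partial\Omega)$ onto $\operatorname{span}\{\psi_1,\dots,\psi_n\}$, and let $\varLambda^{(n)}(\sigma)=P^{(n)}\varLambda(\sigma)P^{(n)}$. Then $\varLambda^{(n)}(\sigma)$ has a spectral representation $\varLambda^{(n)}(\sigma)f=\sum_{k=1}^n\mu_k(f,\varphi_k)\varphi_k$ with $\mu_k>0$ and orthonormal $\varphi_k\in\operatorname{span}\{\psi_1,\dots,\psi_n\}$, and $$\log\varLambda^{(n)}(\sigma)f=\sum_{k=1}^n\log(\mu_k)(f,\varphi_k)\varphi_k$$ does not depend on its choice. The map $$L^\infty_+(\Omega)\ni\sigma\mapsto\log\varLambda^{(n)}(\sigma)\in\mathcal L(L^2_\diamond(\partial\Omega))$$ is Fréchet differentiable, and for every choice of the eigensystem $\{\mu_k,\varphi_k\}$ of $\varLambda^{(n)}(\sigma)$ its derivative at $\sigma\in L^\infty_+(\Omega)$ in the direction $\eta\in L^\infty(\Omega;\mathbb R)$ is $$D\log\varLambda^{(n)}(\sigma;\eta)f=\sum_{j=1}^n\sum_{k=1}^n\frac{\log\mu_j-\log\mu_k}{\mu_j-\mu_k}\,(f,\varphi_k)\,\big(D\varLambda(\sigma;\eta)\varphi_k,\varphi_j\big)\,\varphi_j,\qquad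 f\in L^2_\diamond(\partial\Omega),$$ where the quotient is read as $1/\mu_j$ if $\mu_j=\mu_k$. -/

import Mathlib

open MeasureTheory Filter Topology
open scoped ContDiff ENNReal NNReal

noncomputable section

namespace EIT

/-- The Euclidean space `ℝ^d`. -/
abbrev E (d : ℕ) : Type := EuclideanSpace ℝ (Fin d)

/-- A bounded Lipschitz domain: a bounded connected (in particular nonempty) open set which, near
each of its boundary points `x`, is the strict epigraph of a Lipschitz function over the hyperplane
orthogonal to some unit vector `e`. The function is written as a Lipschitz function on the
whole space that is evaluated only at `y - ⟪e, y⟫ e`, the orthogonal projection of `y` to the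
hyperplane. -/
structure IsBoundedLipschitzDomain {d : ℕ} (Ω : Set (E d)) : Prop where
  isOpen : IsOpen Ω
  isConnected : IsConnected Ω
  isBounded : Bornology.IsBounded Ω
  lipschitz_boundary : ∀ x ∈ frontier Ω, ∃ (e : E d) (K : ℝ≥0) (γ : E d → ℝ) (r : ℝ),
    ‖e‖ = 1 ∧ LipschitzWith K γ ∧ 0 < r ∧
      Ω ∩ Metric.ball x r = {y | γ (y - inner ℝ e y • e) < inner ℝ e y} ∩ Metric.ball x r

/-- The surface measure on `∂Ω`: the normalized `(d-1)`-dimensional Hausdorff measure. -/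
def surfaceMeasure {d : ℕ} (Ω : Set (E d)) : Measure (E d) :=
  (Measure.euclideanHausdorffMeasure (d - 1) : Measure (E d)).restrict (frontier Ω)

/-- `L^∞(Ω; ℝ)`. -/
abbrev Linfty {d : ℕ} (Ω : Set (E d)) : Type := Lp ℝ ∞ (volume.restrict Ω)

/-- `L^∞_+(Ω)`: the functions bounded from below by a positive constant a.e. -/
def LinftyPos {d : ℕ} (Ω : Set (E d)) : Set (Linfty Ω) :=
  {σ | ∃ a : ℝ, 0 < a ∧ ∀ᵐ x ∂(volume.restrict Ω), a ≤ σ x}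

/-- `L²(∂Ω; ℂ)`. -/
abbrev BoundaryL2 {d : ℕ} (Ω : Set (E d)) : Type := Lp ℂ 2 (surfaceMeasure Ω)

/-- `L²_⋄(∂Ω)`: the functions in `L²(∂Ω)` that are orthogonal to the constant function `1`. -/
def meanFree {d : ℕ} (Ω : Set (E d)) : Submodule ℂ (BoundaryL2 Ω) :=
  (Submodule.span ℂ {c : BoundaryL2 Ω | c =ᵐ[surfaceMeasure Ω] fun _ => (1 : ℂ)})ᗮ

/-- `L²_⋄(∂Ω)` as a Hilbert space. -/
abbrev L2diamond {d : ℕ} (Ω : Set (E d)) : Type := meanFree Ω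

/-- The classical gradient of a complex-valued function on `ℝ^d`. -/
def gradC {d : ℕ} (w : E d → ℂ) (x : E d) : EuclideanSpace ℂ (Fin d) :=
  WithLp.toLp 2 fun i => fderiv ℝ w x (EuclideanSpace.single i 1)

/-- `G` is the weak gradient of `u` in `Ω`. -/
def IsWeakGradient {d : ℕ} (Ω : Set (E d)) (u : E d → ℂ)
    (G : E d → EuclideanSpace ℂ (Fin d)) : Prop :=
  ∀ φ : E d → ℂ, ContDiff ℝ ∞ φ → HasCompactSupport φ → tsupport φ ⊆ Ω →
    ∀ i : Fin d, ∫ x in Ω, u x * gradC φ x i = - ∫ x in Ω, G x i * φ x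

/-- The Sobolev space `H¹(Ω)` of complex-valued functions. -/
structure H1 {d : ℕ} (Ω : Set (E d)) where
  val : Lp ℂ 2 (volume.restrict Ω)
  grad : Lp (EuclideanSpace ℂ (Fin d)) 2 (volume.restrict Ω)
  isWeakGradient : IsWeakGradient Ω val grad

/-- `g ∈ L²(∂Ω)` is the boundary trace of `u ∈ H¹(Ω)`: there are smooth functions on `ℝ^d` that
converge to `u` in `H¹(Ω)` and whose restrictions to `∂Ω` converge to `g` in `L²(∂Ω)`.
(If `Ω` is a bounded Lipschitz domain, each `u` has exactly one trace, and this is the usual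
bounded extension of the restriction map.) -/
def H1.HasTrace {d : ℕ} {Ω : Set (E d)} (u : H1 Ω) (g : BoundaryL2 Ω) : Prop :=
  ∃ w : ℕ → E d → ℂ, (∀ k, ContDiff ℝ ∞ (w k)) ∧
    Tendsto (fun k => eLpNorm (fun x => w k x - u.val x) 2 (volume.restrict Ω)) atTop (𝓝 0) ∧
    Tendsto (fun k => eLpNorm (fun x => gradC (w k) x - u.grad x) 2 (volume.restrict Ω))
      atTop (𝓝 0) ∧
    Tendsto (fun k => eLpNorm (fun x => w k x - g x) 2 (surfaceMeasure Ω)) atTop (𝓝 0)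

/-- `u ∈ H¹(Ω)` solves the variational form of `∇·(σ∇u) = 0` in `Ω`, `σ ∂u/∂ν = f` on `∂Ω`:
`∫_Ω σ ∇u · ∇v̄ dx = (f, v|_∂Ω)` for all `v ∈ H¹(Ω)`. (The inner product of Mathlib is
conjugate-linear in its first argument.) -/
def H1.IsNeumannSolution {d : ℕ} {Ω : Set (E d)} (u : H1 Ω) (σ : Linfty Ω)
    (f : BoundaryL2 Ω) : Prop :=
  ∀ (v : H1 Ω) (h : BoundaryL2 Ω), v.HasTrace h →
    ∫ x in Ω, (σ x : ℂ) * inner ℂ (v.grad x) (u.grad x) = inner ℂ h f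

/-- `T` maps every mean-free current density `f` to the mean-free boundary trace of a solution
of the Neumann problem with conductivity `σ`. -/
def IsNeumannToDirichlet {d : ℕ} (Ω : Set (E d)) (σ : Linfty Ω)
    (T : L2diamond Ω →L[ℂ] L2diamond Ω) : Prop :=
  ∀ f : L2diamond Ω, ∃ u : H1 Ω,
    u.IsNeumannSolution σ (f : BoundaryL2 Ω) ∧ u.HasTrace (T f : BoundaryL2 Ω)

open Classical in
/-- The Neumann-to-Dirichlet operator `Λ(σ)` on `L²_⋄(∂Ω)`, that is, the forward operator
`σ ↦ Λ(σ)`. -/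
def ntd {d : ℕ} (Ω : Set (E d)) (σ : Linfty Ω) : L2diamond Ω →L[ℂ] L2diamond Ω :=
  if h : ∃ T, IsNeumannToDirichlet Ω σ T then h.choose else 0

section Hilbert

variable {H : Type*} [NormedAddCommGroup H] [InnerProductSpace ℂ H] {n : ℕ}

/-- The orthogonal projection `∑ₖ (·, ψₖ) ψₖ` onto the span of the orthonormal vectors `ψₖ`. -/
def proj (ψ : Fin n → H) : H →L[ℂ] H := ∑ k, InnerProductSpace.rankOne ℂ (ψ k) (ψ k)

/-- `{μₖ, φₖ}` is a positive orthonormal eigensystem for `T` in `span {ψ₁, …, ψₙ}`, with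
`T f = ∑ₖ μₖ (f, φₖ) φₖ` for all `f`. -/
structure IsSpectralRep (ψ : Fin n → H) (T : H →L[ℂ] H) (μ : Fin n → ℝ) (φ : Fin n → H) :
    Prop where
  pos : ∀ k, 0 < μ k
  orthonormal : Orthonormal ℂ φ
  mem_span : ∀ k, φ k ∈ Submodule.span ℂ (Set.range ψ)
  apply_eq : ∀ f, T f = ∑ k, ((μ k : ℂ) * inner ℂ (φ k) f) • φ k

open Classical in
/-- The logarithm `f ↦ ∑ₖ log(μₖ) (f, φₖ) φₖ` of an operator `T` with a spectral representation
in `span {ψ₁, …, ψₙ}`. -/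
def spectralLog (ψ : Fin n → H) (T : H →L[ℂ] H) : H →L[ℂ] H :=
  if h : ∃ p : (Fin n → ℝ) × (Fin n → H), IsSpectralRep ψ T p.1 p.2 then
    ∑ k, (Real.log (h.choose.1 k) : ℂ) • InnerProductSpace.rankOne ℂ (h.choose.2 k) (h.choose.2 k)
  else 0

end Hilbert

/-- `Λ^(n)(σ) = P^(n) Λ(σ) P^(n)`. -/
def ntdFin {d n : ℕ} (Ω : Set (E d)) (ψ : Fin n → L2diamond Ω) (σ : Linfty Ω) :
    L2diamond Ω →L[ℂ] L2diamond Ω :=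
  proj ψ ∘L ntd Ω σ ∘L proj ψ

/-- `log Λ^(n)(σ)`. -/
def logNtdFin {d n : ℕ} (Ω : Set (E d)) (ψ : Fin n → L2diamond Ω) (σ : Linfty Ω) :
    L2diamond Ω →L[ℂ] L2diamond Ω :=
  spectralLog ψ (ntdFin Ω ψ σ)

/-- The divided difference of the logarithm, with its limit `1 / a` on the diagonal. -/
def logDivDiff (a b : ℝ) : ℝ :=
  if a = b then 1 / a else (Real.log a - Real.log b) / (a - b)

end EIT

end

/-! The proof has an analytic half and a finite-dimensional half.

Analytic half. Let `traced` be the closure of the triples `(w, ∇w, w|∂Ω)`, `w` smooth, in `L²(Ω) ×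
L²(Ω)^d × L²(∂Ω)`; its elements are exactly the triples formed by an `H¹` function, its gradient and
a trace. By the Poincaré and trace inequalities the gradient controls the whole norm on the triples
of mean zero. Lax-Milgram then writes `Λ(σ)` as `tr ∘ A(σ)⁻¹ ∘ tr*`, where `A(σ) = grad* ∘ σ ∘ grad`
is linear in `σ`. Differentiability of `Λ` follows from that of operator inversion; symmetry and
positivity follow from the energy identity and the density of traces. So the compression has a
positive eigensystem for all conductivities near `σ`, because `L^∞_+` is open.

Finite-dimensional half. No perturbation theory of eigenvectors is used. If `T` and `T'` have
eigensystems `{μⱼ, φⱼ}` and `{μ'ₗ, φ'ₗ}` in the same span, then `(μ'ₗ - μⱼ)⟨φⱼ, φ'ₗ⟩ = ⟨φⱼ, (T' -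
T)φ'ₗ⟩`. Expanding both logarithms in the two bases at once gives the exact formula `log T' - log T
= ∑ⱼ Pⱼ (T' - T) qⱼ(T')`, where `Pⱼ` projects onto `φⱼ` and `qⱼ` is the divided difference of `log`
at `μⱼ` (`spectralFun_log_sub`). Taking `T' = T` shows that the logarithm does not depend on the
eigensystem. Letting `T' → T` gives the derivative, once `qⱼ(T') → qⱼ(T)`. This convergence comes
from the same identity: eigenvectors belonging to distant eigenvalues are almost orthogonal
(`norm_spectralFun_sub_le`). -/

noncomputable section

namespace EIT

/-! ### Poincaré inequalities by translation along segments -/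

section

open Set

section Poincare

variable {V : Type*} [NormedAddCommGroup V] [NormedSpace ℝ V]

lemma enorm_add_sq_le {F : Type*} [SeminormedAddCommGroup F] (a b : F) :
    ‖a + b‖ₑ ^ 2 ≤ 2 * (‖a‖ₑ ^ 2 + ‖b‖ₑ ^ 2) := by
  have h : ‖a + b‖₊ ^ 2 ≤ 2 * (‖a‖₊ ^ 2 + ‖b‖₊ ^ 2) :=
    (pow_le_pow_left₀ zero_le (nnnorm_add_le a b) 2).trans <| by
      simpa using add_pow_le (zero_le (a := ‖a‖₊)) (zero_le (a := ‖b‖₊)) 2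
  simp only [enorm_eq_nnnorm]
  exact_mod_cast h

lemma enorm_sub_sq_le {F : Type*} [SeminormedAddCommGroup F] (a b c : F) :
    ‖a - c‖ₑ ^ 2 ≤ 2 * (‖b - a‖ₑ ^ 2 + ‖b - c‖ₑ ^ 2) := by
  have h := enorm_add_sq_le (a - b) (b - c)
  rwa [sub_add_sub_cancel, enorm_sub_rev a b] at h

lemma sq_lintegral_le_measure_mul_lintegral_sq {α : Type*} [MeasurableSpace α] {μ : Measure α}
    {f : α → ℝ≥0∞} (hf : AEMeasurable f μ) :
    (∫⁻ x, f x ∂μ) ^ 2 ≤ μ univ * ∫⁻ x, f x ^ 2 ∂μ := by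
  have h := ENNReal.lintegral_mul_le_Lp_mul_Lq μ Real.HolderConjugate.two_two hf
    (aemeasurable_const (b := (1 : ℝ≥0∞)))
  simp only [Pi.mul_apply, mul_one, lintegral_const, one_mul,
    ENNReal.rpow_two, one_pow] at h
  have hsq : ∀ a : ℝ≥0∞, (a ^ (1 / 2 : ℝ)) ^ 2 = a := fun a => by
    rw [← ENNReal.rpow_two, ← ENNReal.rpow_mul]; norm_num
  calc (∫⁻ x, f x ∂μ) ^ 2 ≤ ((∫⁻ x, f x ^ 2 ∂μ) ^ (1 / 2 : ℝ) * (μ univ) ^ (1 / 2 : ℝ)) ^ 2 := by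
        gcongr
    _ = μ univ * ∫⁻ x, f x ^ 2 ∂μ := by rw [mul_pow, hsq, hsq, mul_comm]

/-- The fundamental theorem of calculus along the segment, then Cauchy-Schwarz. Integrating up to
`t` instead of `τ` makes the bound uniform in `τ`, so that it can be averaged over `τ` in the trace
inequality. -/
lemma enorm_sub_sq_le_lintegral {w : V → ℂ} (hw : ContDiff ℝ 1 w) (x z : V) {τ t : ℝ}
    (hτ : 0 ≤ τ) (hτt : τ ≤ t) :
    ‖w (x + τ • z) - w x‖ₑ ^ 2 ≤ ENNReal.ofReal t * ‖z‖ₑ ^ 2 *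
      ∫⁻ s in Ioo (0 : ℝ) t, ‖fderiv ℝ w (x + s • z)‖ₑ ^ 2 := by
  have hcont : Continuous fun s : ℝ => fderiv ℝ w (x + s • z) :=
    (hw.continuous_fderiv one_ne_zero).comp (by fun_prop)
  have hder : ∀ s : ℝ, HasDerivAt (fun s : ℝ => w (x + s • z)) (fderiv ℝ w (x + s • z) z) s := by
    intro s
    have h1 : HasDerivAt (fun s : ℝ => x + s • z) z s := by
      simpa using ((hasDerivAt_id s).smul_const z).const_add x
    exact ((hw.differentiable one_ne_zero _).hasFDerivAt).comp_hasDerivAt s h1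
  have hint : w (x + τ • z) - w x = ∫ s in Ioo (0 : ℝ) τ, fderiv ℝ w (x + s • z) z := by
    have h := intervalIntegral.integral_eq_sub_of_hasDerivAt (a := 0) (b := τ)
      (fun s _ => hder s) (Continuous.intervalIntegrable (by fun_prop) _ _)
    rw [intervalIntegral.integral_of_le hτ, integral_Ioc_eq_integral_Ioo] at h
    simpa using h.symm
  calc ‖w (x + τ • z) - w x‖ₑ ^ 2
      ≤ (∫⁻ s in Ioo (0 : ℝ) t, ‖fderiv ℝ w (x + s • z)‖ₑ * ‖z‖ₑ) ^ 2 := by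
        rw [hint]
        gcongr
        refine (enorm_integral_le_lintegral_enorm _).trans ((lintegral_mono fun s => ?_).trans
          (lintegral_mono_set (Ioo_subset_Ioo_right hτt)))
        exact ContinuousLinearMap.le_opENorm _ _
    _ = ‖z‖ₑ ^ 2 * (∫⁻ s in Ioo (0 : ℝ) t, ‖fderiv ℝ w (x + s • z)‖ₑ) ^ 2 := by
        rw [lintegral_mul_const' _ _ enorm_ne_top, mul_pow, mul_comm]
    _ ≤ ‖z‖ₑ ^ 2 * (ENNReal.ofReal t *
          ∫⁻ s in Ioo (0 : ℝ) t, ‖fderiv ℝ w (x + s • z)‖ₑ ^ 2) := by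
        gcongr
        simpa using sq_lintegral_le_measure_mul_lintegral_sq
          (μ := volume.restrict (Ioo (0 : ℝ) t)) hcont.enorm.measurable.aemeasurable
    _ = _ := by ring

variable [MeasurableSpace V] {m : Measure V} {Ω : Set V} {c : (V → ℂ) → ℂ}

/-- The functions `w - c w` are controlled in `L²(μ)` by the gradient of `w` in `L²(Ω)`. -/
def Controlled (m : Measure V) (Ω : Set V) (c : (V → ℂ) → ℂ) (μ : Measure V) : Prop :=
  ∃ C : ℝ≥0, ∀ w : V → ℂ, ContDiff ℝ 1 w →
    ∫⁻ x, ‖w x - c w‖ₑ ^ 2 ∂μ ≤ C * ∫⁻ x in Ω, ‖fderiv ℝ w x‖ₑ ^ 2 ∂m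

lemma Controlled.mono {μ ν : Measure V} (h : Controlled m Ω c ν) (hμ : μ ≤ ν) :
    Controlled m Ω c μ := by
  obtain ⟨C, hC⟩ := h
  exact ⟨C, fun w hw => (lintegral_mono' hμ le_rfl).trans (hC w hw)⟩

lemma Controlled.add {μ ν : Measure V} (hμ : Controlled m Ω c μ) (hν : Controlled m Ω c ν) :
    Controlled m Ω c (μ + ν) := by
  obtain ⟨C, hC⟩ := hμ
  obtain ⟨D, hD⟩ := hν
  refine ⟨C + D, fun w hw => ?_⟩
  rw [lintegral_add_measure, ENNReal.coe_add, add_mul]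
  exact add_le_add (hC w hw) (hD w hw)

/-- Local bounds can be added over a finite cover because all of them subtract the same constant `c
w`. -/
lemma Controlled.of_isCompact {μ : Measure V} {K : Set V} (hK : IsCompact K)
    (h : ∀ x ∈ K, ∃ r > 0, Controlled m Ω c (μ.restrict (Metric.ball x r))) :
    Controlled m Ω c (μ.restrict K) := by
  refine hK.induction_on (p := fun s => Controlled m Ω c (μ.restrict s)) ⟨0, by simp⟩
    (fun s t hst ht => ht.mono (Measure.restrict_mono hst le_rfl))
    (fun s t hs ht => (hs.add ht).mono (Measure.restrict_union_le s t)) fun x hx => ?_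
  obtain ⟨r, hr, hc⟩ := h x hx
  exact ⟨_, mem_nhdsWithin_of_mem_nhds (Metric.ball_mem_nhds x hr), hc⟩

variable [BorelSpace V] [FiniteDimensional ℝ V] [m.IsAddHaarMeasure]

/-- After Tonelli, each parameter `s` contributes an integral over `A + s • z ⊆ Ω`, by translation
invariance. -/
lemma lintegral_translate_sub_le (hΩ : MeasurableSet Ω) {w : V → ℂ} (hw : ContDiff ℝ 1 w)
    {A : Set V} (hA : MeasurableSet A) {z : V}
    (hz : ∀ x ∈ A, ∀ s ∈ Ioo (0 : ℝ) 1, x + s • z ∈ Ω) :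
    ∫⁻ x in A, ‖w (x + z) - w x‖ₑ ^ 2 ∂m ≤
      ‖z‖ₑ ^ 2 * ∫⁻ x in Ω, ‖fderiv ℝ w x‖ₑ ^ 2 ∂m := by
  have hmeas : Measurable fun p : V × ℝ => ‖fderiv ℝ w (p.1 + p.2 • z)‖ₑ ^ 2 := by
    have h : Continuous fun p : V × ℝ => fderiv ℝ w (p.1 + p.2 • z) :=
      (hw.continuous_fderiv one_ne_zero).comp (by fun_prop)
    exact h.enorm.measurable.pow_const 2
  calc ∫⁻ x in A, ‖w (x + z) - w x‖ₑ ^ 2 ∂m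
      ≤ ∫⁻ x in A, ‖z‖ₑ ^ 2 * (∫⁻ s in Ioo (0 : ℝ) 1, ‖fderiv ℝ w (x + s • z)‖ₑ ^ 2) ∂m :=
        lintegral_mono fun x => by
          simpa using enorm_sub_sq_le_lintegral hw x z zero_le_one le_rfl
    _ = ‖z‖ₑ ^ 2 * ∫⁻ s in Ioo (0 : ℝ) 1, ∫⁻ x in A, ‖fderiv ℝ w (x + s • z)‖ₑ ^ 2 ∂m := by
        rw [lintegral_const_mul' _ _ (by simp), lintegral_lintegral_swap hmeas.aemeasurable]
    _ ≤ ‖z‖ₑ ^ 2 * ∫⁻ s in Ioo (0 : ℝ) 1, ∫⁻ x in Ω, ‖fderiv ℝ w x‖ₑ ^ 2 ∂m := by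
        refine mul_le_mul_right ?_ _
        refine setLIntegral_mono measurable_const fun s hs => ?_
        rw [← lintegral_indicator hA, ← lintegral_indicator hΩ,
          ← lintegral_add_right_eq_self (Ω.indicator _) (s • z)]
        refine lintegral_mono fun x => ?_
        by_cases hx : x ∈ A
        · simp [hx, hz x hx s hs]
        · simp [hx]
    _ = _ := by simp

/-- Control is transported backwards along a translation inside `Ω`. -/
lemma Controlled.translate (hΩ : MeasurableSet Ω) {A B : Set V} (hA : MeasurableSet A)
    (hB : MeasurableSet B) (h : Controlled m Ω c (m.restrict B)) {z : V}
    (hz : ∀ x ∈ A, ∀ s ∈ Ioo (0 : ℝ) 1, x + s • z ∈ Ω) (hzB : ∀ x ∈ A, x + z ∈ B) :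
    Controlled m Ω c (m.restrict A) := by
  obtain ⟨C, hC⟩ := h
  refine ⟨2 * (‖z‖₊ ^ 2 + C), fun w hw => ?_⟩
  have hwc := hw.continuous
  calc ∫⁻ x in A, ‖w x - c w‖ₑ ^ 2 ∂m
      ≤ ∫⁻ x in A, 2 * (‖w (x + z) - w x‖ₑ ^ 2 + ‖w (x + z) - c w‖ₑ ^ 2) ∂m :=
        lintegral_mono fun x => enorm_sub_sq_le _ _ _
    _ = 2 * (∫⁻ x in A, ‖w (x + z) - w x‖ₑ ^ 2 ∂m + ∫⁻ x in A, ‖w (x + z) - c w‖ₑ ^ 2 ∂m) := by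
        rw [lintegral_const_mul' _ _ (by simp), lintegral_add_left]
        fun_prop
    _ ≤ 2 * (‖z‖ₑ ^ 2 * (∫⁻ x in Ω, ‖fderiv ℝ w x‖ₑ ^ 2 ∂m) +
          C * ∫⁻ x in Ω, ‖fderiv ℝ w x‖ₑ ^ 2 ∂m) := by
        gcongr
        · exact lintegral_translate_sub_le hΩ hw hA hz
        · refine le_trans ?_ (hC w hw)
          rw [← lintegral_indicator hA, ← lintegral_indicator hB,
            ← lintegral_add_right_eq_self (B.indicator _) z]
          refine lintegral_mono fun x => ?_
          by_cases hx : x ∈ A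
          · simp [hx, hzB x hx]
          · simp [hx]
    _ = _ := by
        rw [← add_mul, ← mul_assoc]
        push_cast
        rw [enorm_eq_nnnorm]

/-- A Poincaré inequality on a ball whose threefold enlargement lies in `Ω`. -/
lemma exists_controlled_ball (hΩ : MeasurableSet Ω) {x₀ : V} {r : ℝ} (hr : 0 < r)
    (hball : Metric.ball x₀ (3 * r) ⊆ Ω) :
    ∃ c, Controlled m Ω c (m.restrict (Metric.ball x₀ r)) := by
  set B := Metric.ball x₀ r with hB
  have hB0 : m B ≠ 0 := (Metric.measure_ball_pos m x₀ hr).ne'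
  have hBt : m B ≠ ⊤ := measure_ball_lt_top.ne
  set Z := Metric.ball (0 : V) (2 * r) with hZ
  have hZt : m Z ≠ ⊤ := measure_ball_lt_top.ne
  set C : ℝ≥0∞ := (m B)⁻¹ * (m Z * ENNReal.ofReal (2 * r) ^ 2) with hC
  have hCt : C ≠ ⊤ := by
    rw [hC]
    exact ENNReal.mul_ne_top (ENNReal.inv_ne_top.2 hB0) 
      (ENNReal.mul_ne_top hZt (ENNReal.pow_ne_top ENNReal.ofReal_ne_top))
  have key : ∀ w : V → ℂ, ContDiff ℝ 1 w → ∃ y : V, ∫⁻ x in B, ‖w x - w y‖ₑ ^ 2 ∂m ≤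
      C * ∫⁻ x in Ω, ‖fderiv ℝ w x‖ₑ ^ 2 ∂m := by
    intro w hw
    have hwc := hw.continuous
    have hm : Measurable fun p : V × V => ‖w p.2 - w p.1‖ₑ ^ 2 := by
      have h : Continuous fun p : V × V => w p.2 - w p.1 := by fun_prop
      exact h.enorm.measurable.pow_const 2
    -- A point value `w y` replaces the mean of `w`: some `y` does at least as well as the average
    -- over `B`. The resulting double integral is treated by substituting `x = y + z` with `‖z‖ <
    -- 2r`; segments from `B` along such `z` stay in the ball of radius `3r`.
    obtain ⟨y, hy, hle⟩ := exists_le_setLAverage (μ := m) (s := B)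
      (f := fun y => ∫⁻ x in B, ‖w x - w y‖ₑ ^ 2 ∂m) hB0 hBt
      (Measurable.lintegral_prod_right' (ν := m.restrict B) hm).aemeasurable
    refine ⟨y, hle.trans ?_⟩
    rw [setLAverage_eq, div_eq_mul_inv, mul_comm, hC, mul_assoc]
    gcongr
    have hm' : Measurable fun p : V × V => ‖w (p.1 + p.2) - w p.1‖ₑ ^ 2 := by
      have h : Continuous fun p : V × V => w (p.1 + p.2) - w p.1 := by fun_prop
      exact h.enorm.measurable.pow_const 2
    calc ∫⁻ y in B, ∫⁻ x in B, ‖w x - w y‖ₑ ^ 2 ∂m ∂m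
        ≤ ∫⁻ y in B, ∫⁻ z in Z, ‖w (y + z) - w y‖ₑ ^ 2 ∂m ∂m := by
          refine setLIntegral_mono (Measurable.lintegral_prod_right' (ν := m.restrict Z) hm')
            fun y hy => ?_
          rw [← lintegral_indicator measurableSet_ball, ← lintegral_indicator measurableSet_ball,
            ← lintegral_add_left_eq_self (B.indicator _) y]
          refine lintegral_mono fun z => ?_
          by_cases hz : y + z ∈ B
          · have : z ∈ Z := by
              simp only [hZ, hB, Metric.mem_ball, dist_zero_right] at hy hz ⊢
              calc ‖z‖ = dist (y + z) y := by simp [dist_eq_norm]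
                _ ≤ dist (y + z) x₀ + dist y x₀ := dist_triangle_right _ _ _
                _ < 2 * r := by linarith
            rw [indicator_of_mem hz,
              indicator_of_mem (show z ∈ Metric.ball (0 : V) (2 * r) from this)]
          · rw [indicator_of_notMem hz]
            exact zero_le
      _ = ∫⁻ z in Z, ∫⁻ y in B, ‖w (y + z) - w y‖ₑ ^ 2 ∂m ∂m :=
          lintegral_lintegral_swap hm'.aemeasurable
      _ ≤ ∫⁻ z in Z, ENNReal.ofReal (2 * r) ^ 2 * ∫⁻ x in Ω, ‖fderiv ℝ w x‖ₑ ^ 2 ∂m ∂m := by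
          refine setLIntegral_mono measurable_const fun z hz => ?_
          have hz' : ‖z‖ < 2 * r := by simpa [hZ] using hz
          refine (lintegral_translate_sub_le hΩ hw measurableSet_ball fun x hx s hs => hball ?_
            ).trans ?_
          · have hx' : dist x x₀ < r := hx
            rw [Metric.mem_ball]
            calc dist (x + s • z) x₀ ≤ dist (x + s • z) x + dist x x₀ := dist_triangle _ _ _
              _ = s * ‖z‖ + dist x x₀ := by simp [dist_eq_norm, norm_smul, abs_of_pos hs.1]
              _ < 3 * r := by nlinarith [hs.1, hs.2, norm_nonneg z]
          · gcongr
            rw [← ofReal_norm]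
            exact ENNReal.ofReal_le_ofReal hz'.le
      _ = _ := by
          rw [setLIntegral_const]
          ring
  classical
  choose! y hy using key
  refine ⟨fun w => w (y w), C.toNNReal, fun w hw => ?_⟩
  rw [ENNReal.coe_toNNReal hCt]
  exact hy w hw

/-- On a connected open set, all small balls are controlled by the gradient with one and the same
choice of the constants. -/
lemma exists_forall_controlled_ball (hΩ : IsOpen Ω) (hconn : IsConnected Ω) :
    ∃ c, ∀ x ∈ Ω, ∃ r > 0, Controlled m Ω c (m.restrict (Metric.ball x r)) := by
  obtain ⟨x₀, hx₀⟩ := hconn.nonempty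
  obtain ⟨R, hR, hball⟩ := Metric.isOpen_iff.1 hΩ x₀ hx₀
  obtain ⟨c, hc⟩ := exists_controlled_ball (m := m) hΩ.measurableSet (x₀ := x₀) (r := R / 3)
    (by positivity) (by rwa [mul_div_cancel₀ _ (by norm_num)])
  refine ⟨c, ?_⟩
  set G := {x | ∃ r > 0, Controlled m Ω c (m.restrict (Metric.ball x r))} with hG
  have hGo : IsOpen G := by
    refine Metric.isOpen_iff.2 fun x ⟨r, hr, h⟩ => ⟨r / 2, by positivity, fun y hy => ?_⟩
    refine ⟨r / 2, by positivity, h.mono (Measure.restrict_mono (Metric.ball_subset ?_) le_rfl)⟩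
    have hy' : dist y x < r / 2 := hy
    linarith
  -- The controlled points form a relatively clopen set: a limit point in `Ω` inherits control from
  -- a nearby controlled point by translation.
  refine hconn.isPreconnected.subset_of_closure_inter_subset hGo
    ⟨x₀, hx₀, R / 3, by positivity, hc⟩ fun x ⟨hx, hxΩ⟩ => ?_
  obtain ⟨ρ, hρ, hρΩ⟩ := Metric.isOpen_iff.1 hΩ x hxΩ
  obtain ⟨y, ⟨r, hr, hy⟩, hyx⟩ := Metric.mem_closure_iff.1 hx (ρ / 2) (by positivity)
  have hyx' : ‖y - x‖ < ρ / 2 := by rwa [dist_comm, dist_eq_norm] at hyx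
  refine ⟨min r (ρ / 2), by positivity, hy.translate hΩ.measurableSet measurableSet_ball
    measurableSet_ball (z := y - x) (fun a ha s hs => hρΩ ?_) fun a ha => ?_⟩
  · have ha' : dist a x < ρ / 2 := lt_of_lt_of_le ha (min_le_right _ _)
    rw [Metric.mem_ball]
    calc dist (a + s • (y - x)) x ≤ dist (a + s • (y - x)) a + dist a x := dist_triangle _ _ _
      _ = s * ‖y - x‖ + dist a x := by simp [dist_eq_norm, norm_smul, abs_of_pos hs.1]
      _ < ρ := by nlinarith [hs.1, hs.2, norm_nonneg (y - x)]
  · have ha' : dist a x < r := lt_of_lt_of_le ha (min_le_left _ _)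
    rw [Metric.mem_ball]
    convert ha' using 1
    simp only [dist_eq_norm]
    congr 1
    abel

end Poincare

end

/-! ### Surface measure and integration over Lipschitz graphs -/

section

open Set

section Graph

variable {V : Type*} [NormedAddCommGroup V] [InnerProductSpace ℝ V]

lemma euclideanHausdorffMeasure_image_le {X Y : Type*} [EMetricSpace X] [MeasurableSpace X]
    [BorelSpace X] [EMetricSpace Y] [MeasurableSpace Y] [BorelSpace Y] {K : ℝ≥0} {f : X → Y}
    (hf : LipschitzWith K f) (k : ℕ) (s : Set X) :
    Measure.euclideanHausdorffMeasure k (f '' s) ≤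
      (K : ℝ≥0∞) ^ k * Measure.euclideanHausdorffMeasure k s := by
  simp only [Measure.euclideanHausdorffMeasure_def, Measure.smul_apply, ENNReal.smul_def,
    smul_eq_mul]
  rw [mul_left_comm]
  gcongr
  simpa using hf.hausdorffMeasure_image_le (Nat.cast_nonneg k) s

/-- The parametrization of the graph of `γ` in direction `e` over the hyperplane `eᗮ`. -/
def graphMap (e : V) (γ : V → ℝ) (p : (ℝ ∙ e)ᗮ) : V := (p : V) + γ p • e

lemma lipschitzWith_graphMap {e : V} (he : ‖e‖ = 1) {K : ℝ≥0} {γ : V → ℝ}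
    (hγ : LipschitzWith K γ) : LipschitzWith (1 + K) (graphMap e γ) := by
  refine LipschitzWith.subtype_val _ |>.add (LipschitzWith.of_dist_le_mul fun p q => ?_)
  rw [dist_eq_norm, ← sub_smul, norm_smul, he, mul_one, ← dist_eq_norm]
  exact hγ.dist_le_mul _ _

lemma exists_graphMap_eq {e : V} (he : ‖e‖ = 1) {γ : V → ℝ} {y : V}
    (hy : inner ℝ e y = γ (y - inner ℝ e y • e)) :
    ∃ p, graphMap e γ p = y ∧ ‖p‖ ≤ ‖y‖ := by
  have hmem : y - inner ℝ e y • e ∈ (ℝ ∙ e)ᗮ := by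
    rw [Submodule.mem_orthogonal_singleton_iff_inner_right, inner_sub_right, inner_smul_right,
      real_inner_self_eq_norm_sq, he]
    ring
  refine ⟨⟨_, hmem⟩, by simp [graphMap, ← hy], ?_⟩
  have h := norm_add_sq_eq_norm_sq_add_norm_sq_of_inner_eq_zero (y - inner ℝ e y • e)
    (inner ℝ e y • e) (by
      rw [real_inner_comm]
      exact Submodule.inner_right_of_mem_orthogonal
        (Submodule.smul_mem _ _ (Submodule.mem_span_singleton_self e)) hmem)
  rw [sub_add_cancel] at h
  exact abs_le_of_sq_le_sq' (by
    rw [Submodule.coe_norm]; nlinarith [norm_nonneg (inner ℝ e y • e)]) (norm_nonneg y) |>.2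

variable [FiniteDimensional ℝ V] [MeasurableSpace V] [BorelSpace V]

/-- Tonelli for the orthogonal decomposition `V = eᗮ ⊕ ℝ e`. -/
lemma lintegral_eq_lintegral_orthogonal_lintegral_line {e : V} (he : ‖e‖ = 1) {F : V → ℝ≥0∞}
    (hF : Measurable F) :
    ∫⁻ p : (ℝ ∙ e)ᗮ, ∫⁻ τ : ℝ, F ((p : V) + τ • e) = ∫⁻ x, F x := by
  have h1 := ((ℝ ∙ e).measurePreserving_measurableEquivProd (0 : V)).symm
  rw [InnerProductSpace.euclideanHausdorffMeasure_eq_volume] at h1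
  have h2 := (LinearIsometryEquiv.toSpanUnitSingleton (𝕜 := ℝ) e he).measurePreserving
  rw [← h1.lintegral_comp hF, Measure.volume_eq_prod, lintegral_prod_symm' _ (by fun_prop)]
  refine lintegral_congr fun p => ?_
  rw [← h2.lintegral_comp (by fun_prop)]
  refine lintegral_congr fun τ => ?_
  simp [Submodule.measurableEquivProd_symm_apply, add_comm]

variable {k : ℕ} (hk : Module.finrank ℝ V = k + 1) {e : V} (he : ‖e‖ = 1) {K : ℝ≥0} {γ : V → ℝ}
  (hγ : LipschitzWith K γ) {S : Set V} (hS : ∀ y ∈ S, inner ℝ e y = γ (y - inner ℝ e y • e))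

include hk he hγ hS

/-- `A` is covered by the `(1 + K)`-Lipschitz image of its shadow in `eᗮ`, on which the normalized
Hausdorff measure is Lebesgue measure. -/
lemma hausdorffMeasure_graph_le {A : Set V} (hA : A ⊆ S) :
    Measure.euclideanHausdorffMeasure k A ≤
      ((1 + K : ℝ≥0) : ℝ≥0∞) ^ k * volume (graphMap e γ ⁻¹' A) := by
  have hsub : A ⊆ graphMap e γ '' (graphMap e γ ⁻¹' A) := fun y hy => by
    obtain ⟨p, hp, -⟩ := exists_graphMap_eq he (hS y (hA hy))
    exact ⟨p, by simpa [hp] using hy, hp⟩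
  have hrank : Module.finrank ℝ (ℝ ∙ e)ᗮ = k := by
    have h1 := (ℝ ∙ e).finrank_add_finrank_orthogonal
    rw [finrank_span_singleton (by rintro rfl; simp at he), hk] at h1
    omega
  have hvol : (Measure.euclideanHausdorffMeasure k : Measure (ℝ ∙ e)ᗮ) = volume := by
    rw [← hrank, InnerProductSpace.euclideanHausdorffMeasure_eq_volume]
  exact (measure_mono hsub).trans <|
    (euclideanHausdorffMeasure_image_le (lipschitzWith_graphMap he hγ) k _).trans_eq (by rw [hvol])

lemma hausdorffMeasure_graph_lt_top (hb : Bornology.IsBounded S) :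
    Measure.euclideanHausdorffMeasure k S < ⊤ := by
  obtain ⟨R, hR⟩ := hb.exists_norm_le
  refine (hausdorffMeasure_graph_le hk he hγ hS le_rfl).trans_lt
    (ENNReal.mul_lt_top (by simp) (lt_of_le_of_lt (measure_mono fun p hp => ?_)
      (measure_closedBall_lt_top (x := 0) (r := R))))
  have hp' : p.1 + γ p.1 • e ∈ S := hp
  rw [mem_closedBall_zero_iff]
  obtain ⟨q, hq, hqn⟩ := exists_graphMap_eq he (hS _ hp')
  -- The graph parametrization is injective, so the norm bound for `q` applies to `p`.
  have hpq : p = q := by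
    have h0 : (p : V) - q = (γ q - γ p) • e := by
      rw [sub_smul, sub_eq_sub_iff_add_eq_add, add_comm _ (q : V)]
      exact hq.symm
    have h1 : (p : V) - q ∈ (ℝ ∙ e)ᗮ := Submodule.sub_mem _ p.2 q.2
    have h2 : (p : V) - q ∈ ℝ ∙ e := by
      rw [h0]; exact Submodule.smul_mem _ _ (Submodule.mem_span_singleton_self e)
    have h3 : inner ℝ ((p : V) - q) ((p : V) - q) = (0 : ℝ) :=
      Submodule.inner_right_of_mem_orthogonal h2 h1
    exact Subtype.ext (sub_eq_zero.1 (inner_self_eq_zero.1 h3))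
  rw [hpq]
  exact hqn.trans (hR _ hp')

/-- The surface measure on the graph is at most `(1 + K)^k` times the image of Lebesgue measure on
`eᗮ`. The inner integral runs over the whole line, so shifting it by `γ p` removes the graph and
leaves Tonelli. -/
lemma lintegral_graph_le {F : V → ℝ≥0∞} (hF : Measurable F) :
    ∫⁻ y in S, ∫⁻ τ : ℝ, F (y + τ • e) ∂volume ∂(Measure.euclideanHausdorffMeasure k) ≤
      ((1 + K : ℝ≥0) : ℝ≥0∞) ^ k * ∫⁻ x, F x := by
  have hg : Measurable (graphMap e γ) := (lipschitzWith_graphMap he hγ).continuous.measurable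
  have hle : (Measure.euclideanHausdorffMeasure k : Measure V).restrict S ≤
      ((1 + K : ℝ≥0) : ℝ≥0∞) ^ k • Measure.map (graphMap e γ) volume := by
    refine Measure.le_iff.2 fun A hA => ?_
    rw [Measure.restrict_apply hA, Measure.smul_apply, Measure.map_apply hg hA, smul_eq_mul]
    refine (hausdorffMeasure_graph_le hk he hγ hS inter_subset_right).trans ?_
    gcongr
    exact inter_subset_left
  have hF' : Measurable fun y => ∫⁻ τ : ℝ, F (y + τ • e) :=
    Measurable.lintegral_prod_right' (f := fun p : V × ℝ => F (p.1 + p.2 • e)) (by fun_prop)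
  refine (lintegral_mono' hle le_rfl).trans ?_
  rw [lintegral_smul_measure, lintegral_map hF' hg, smul_eq_mul,
    ← lintegral_eq_lintegral_orthogonal_lintegral_line he hF]
  refine mul_le_mul_right (lintegral_mono fun p => ?_) _
  rw [← lintegral_add_left_eq_self (fun τ => F ((p : V) + τ • e)) (γ p)]
  simp only [graphMap, add_smul, add_assoc]
  exact le_rfl

end Graph

end

/-! ### Poincaré and trace inequalities on bounded Lipschitz domains -/

section

open Set

section Epigraph

variable {V : Type*} [NormedAddCommGroup V] [InnerProductSpace ℝ V] {Ω : Set V} {x e : V}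
  {γ : V → ℝ} {r : ℝ}

lemma le_inner_of_mem_closure_epigraph (hγ : Continuous γ)
    (h : Ω ∩ Metric.ball x r = {y | γ (y - inner ℝ e y • e) < inner ℝ e y} ∩ Metric.ball x r)
    {y : V} (hy : y ∈ closure Ω) (hyr : y ∈ Metric.ball x r) :
    γ (y - inner ℝ e y • e) ≤ inner ℝ e y := by
  have hcl : y ∈ closure (Ω ∩ Metric.ball x r) :=
    mem_closure_iff_nhds.2 fun t ht => by
      obtain ⟨z, hz, hzΩ⟩ := mem_closure_iff_nhds.1 hy _
        (inter_mem ht (Metric.isOpen_ball.mem_nhds hyr))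
      exact ⟨z, hz.1, hzΩ, hz.2⟩
  refine closure_minimal (t := {y | γ (y - inner ℝ e y • e) ≤ inner ℝ e y}) (fun z hz => ?_)
    (isClosed_le (by fun_prop) (by fun_prop)) hcl
  rw [h] at hz
  exact le_of_lt (show γ (z - inner ℝ e z • e) < inner ℝ e z from hz.1)

lemma inner_eq_of_mem_frontier_epigraph (hΩ : IsOpen Ω) (hγ : Continuous γ)
    (h : Ω ∩ Metric.ball x r = {y | γ (y - inner ℝ e y • e) < inner ℝ e y} ∩ Metric.ball x r)
    {y : V} (hy : y ∈ frontier Ω) (hyr : y ∈ Metric.ball x r) :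
    inner ℝ e y = γ (y - inner ℝ e y • e) := by
  rw [hΩ.frontier_eq] at hy
  refine le_antisymm (not_lt.1 fun hlt => hy.2 ?_) (le_inner_of_mem_closure_epigraph hγ h hy.1 hyr)
  have : y ∈ Ω ∩ Metric.ball x r := by rw [h]; exact ⟨hlt, hyr⟩
  exact this.1

/-- Moving by `t • e` keeps the projection to `eᗮ` and raises the height by `t`, so the weak
inequality on the closure becomes strict. This supplies the segments inside `Ω` that start at the
boundary. -/
lemma add_smul_mem_of_mem_closure_epigraph (he : ‖e‖ = 1) (hγ : Continuous γ)
    (h : Ω ∩ Metric.ball x r = {y | γ (y - inner ℝ e y • e) < inner ℝ e y} ∩ Metric.ball x r)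
    {y : V} (hy : y ∈ closure Ω) {t : ℝ} (ht : 0 < t) (hyt : dist y x + t < r) :
    y + t • e ∈ Ω := by
  have hyr : y ∈ Metric.ball x r := by rw [Metric.mem_ball]; linarith
  have hle := le_inner_of_mem_closure_epigraph hγ h hy hyr
  have hin : inner ℝ e (y + t • e) = inner ℝ e y + t := by
    rw [inner_add_right, inner_smul_right, real_inner_self_eq_norm_sq, he]
    ring
  have : y + t • e ∈ Ω ∩ Metric.ball x r := by
    rw [h]
    refine ⟨?_, ?_⟩
    · have hproj : y + t • e - (inner ℝ e y + t) • e = y - inner ℝ e y • e := by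
        rw [add_smul]; abel
      rw [mem_ofPred_eq, hin, hproj]
      linarith
    · rw [Metric.mem_ball]
      calc dist (y + t • e) x ≤ dist (y + t • e) y + dist y x := dist_triangle _ _ _
        _ = t + dist y x := by simp [dist_eq_norm, norm_smul, he, abs_of_pos ht]
        _ < r := by linarith
  exact this.1

end Epigraph

namespace IsBoundedLipschitzDomain

variable {d : ℕ} {Ω : Set (E d)} (hΩ : IsBoundedLipschitzDomain Ω)

include hΩ

lemma isCompact_closure : IsCompact (closure Ω) := hΩ.isBounded.isCompact_closure

lemma isCompact_frontier : IsCompact (frontier Ω) :=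
  hΩ.isCompact_closure.of_isClosed_subset isClosed_frontier frontier_subset_closure

lemma volume_lt_top : volume Ω < ⊤ := hΩ.isBounded.measure_lt_top

lemma volume_pos : 0 < volume Ω := hΩ.isOpen.measure_pos _ hΩ.isConnected.nonempty

/-- The Poincaré inequality, for continuously differentiable functions. -/
lemma exists_controlled : ∃ c, Controlled volume Ω c (volume.restrict Ω) := by
  obtain ⟨c, hc⟩ := exists_forall_controlled_ball (m := volume) hΩ.isOpen hΩ.isConnected
  refine ⟨c, ?_⟩
  have h : Controlled volume Ω c ((volume.restrict Ω).restrict (closure Ω)) := by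
    refine Controlled.of_isCompact hΩ.isCompact_closure fun x hx => ?_
    by_cases hxΩ : x ∈ Ω
    · obtain ⟨r, hr, h⟩ := hc x hxΩ
      exact ⟨r, hr, h.mono (Measure.restrict_mono_measure Measure.restrict_le_self _)⟩
    have hxf : x ∈ frontier Ω := by rw [hΩ.isOpen.frontier_eq]; exact ⟨hx, hxΩ⟩
    -- Near a boundary point, translation by `(r / 2) • e` moves the part of `Ω` close to `x`
    -- through `Ω` into a small ball about an interior point, where control is known.
    obtain ⟨e, K, γ, r, he, hγ, hr, h⟩ := hΩ.lipschitz_boundary x hxf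
    have hx' : x + (r / 2) • e ∈ Ω :=
      add_smul_mem_of_mem_closure_epigraph he hγ.continuous h hx (by positivity)
        (by rw [dist_self]; linarith)
    obtain ⟨ρ, hρ, hctrl⟩ := hc _ hx'
    refine ⟨min ρ (r / 2), by positivity, ?_⟩
    rw [Measure.restrict_restrict measurableSet_ball]
    refine hctrl.translate hΩ.isOpen.measurableSet
      (measurableSet_ball.inter hΩ.isOpen.measurableSet) measurableSet_ball
      (z := (r / 2) • e) (fun y hy s hs => ?_) fun y hy => ?_
    · have hy' : dist y x < r / 2 := lt_of_lt_of_le hy.1 (min_le_right _ _)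
      rw [smul_smul]
      exact add_smul_mem_of_mem_closure_epigraph he hγ.continuous h (subset_closure hy.2)
        (mul_pos hs.1 (by positivity)) (by nlinarith [hs.1, hs.2])
    · have hy' : dist y x < ρ := lt_of_lt_of_le hy.1 (min_le_left _ _)
      simpa [Metric.mem_ball, dist_add_right] using hy'
  rwa [Measure.restrict_restrict isClosed_closure.measurableSet,
    inter_eq_right.2 subset_closure] at h

lemma exists_surfaceMeasure_ball_lt_top (hd : 1 ≤ d) {x : E d} (hx : x ∈ frontier Ω) :
    ∃ r > 0, surfaceMeasure Ω (Metric.ball x r) < ⊤ := by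
  obtain ⟨e, K, γ, r, he, hγ, hr, h⟩ := hΩ.lipschitz_boundary x hx
  refine ⟨r, hr, ?_⟩
  rw [surfaceMeasure, Measure.restrict_apply measurableSet_ball]
  exact hausdorffMeasure_graph_lt_top (by simp; omega) he hγ
    (fun y hy => inner_eq_of_mem_frontier_epigraph hΩ.isOpen hγ.continuous h hy.2 hy.1)
    (Metric.isBounded_ball.subset inter_subset_left)

lemma isFiniteMeasure_surfaceMeasure (hd : 1 ≤ d) : IsFiniteMeasure (surfaceMeasure Ω) := by
  have h : surfaceMeasure Ω (frontier Ω) < ⊤ := by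
    refine hΩ.isCompact_frontier.measure_lt_top_of_nhdsWithin fun x hx => ?_
    obtain ⟨r, hr, h⟩ := hΩ.exists_surfaceMeasure_ball_lt_top hd hx
    exact ⟨_, mem_nhdsWithin_of_mem_nhds (Metric.ball_mem_nhds x hr), h⟩
  rw [surfaceMeasure, Measure.restrict_apply_self] at h
  exact isFiniteMeasure_restrict.2 h.ne

/-- The trace inequality, for continuously differentiable functions. -/
lemma controlled_surfaceMeasure (hd : 1 ≤ d) {c : (E d → ℂ) → ℂ}
    (hc : Controlled volume Ω c (volume.restrict Ω)) :
    Controlled volume Ω c (surfaceMeasure Ω) := by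
  have hself : (surfaceMeasure Ω).restrict (frontier Ω) = surfaceMeasure Ω := by
    rw [surfaceMeasure, Measure.restrict_restrict isClosed_frontier.measurableSet, inter_self]
  rw [← hself]
  refine Controlled.of_isCompact hΩ.isCompact_frontier fun x hx => ?_
  obtain ⟨e, K, γ, r, he, hγ, hr, h⟩ := hΩ.lipschitz_boundary x hx
  obtain ⟨C, hC⟩ := hc
  set t := r / 2 with ht
  have ht0 : 0 < t := by positivity
  set S := Metric.ball x t ∩ frontier Ω with hS
  have hSm : MeasurableSet S := measurableSet_ball.inter isClosed_frontier.measurableSet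
  set t' : ℝ≥0 := t.toNNReal with ht'
  have ht'0 : t' ≠ 0 := by simpa [ht'] using ht0
  -- `t'⁻¹` comes from averaging over segments of length `t`, the 2 from squaring a sum, `(1 + K) ^
  -- (d - 1)` from the graph, `t' ^ 2` from the gradient along the segments and `C` from the
  -- Poincaré inequality.
  refine ⟨t, ht0, t'⁻¹ * (2 * ((1 + K) ^ (d - 1) * (t' ^ 2 + C))), fun w hw => ?_⟩
  rw [surfaceMeasure, Measure.restrict_restrict measurableSet_ball]
  set D := ∫⁻ x in Ω, ‖fderiv ℝ w x‖ₑ ^ 2 with hD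
  have hwc := hw.continuous
  have hw' := hw.continuous_fderiv one_ne_zero
  set F : E d → ℝ≥0∞ := Ω.indicator fun y =>
    (t' : ℝ≥0∞) ^ 2 * ‖fderiv ℝ w y‖ₑ ^ 2 + ‖w y - c w‖ₑ ^ 2 with hF
  have hFm : Measurable F :=
    Measurable.indicator ((hw'.enorm.measurable.pow_const 2).const_mul _ |>.add
      ((hwc.sub continuous_const).enorm.measurable.pow_const 2)) hΩ.isOpen.measurableSet
  -- Compare `w y` with `w (y + τ • e)` and integrate over `0 < τ < t`. As `t = r / 2`, these
  -- segments stay in the chart, hence in `Ω`.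
  have hpt : ∀ y ∈ S, (t' : ℝ≥0∞) * ‖w y - c w‖ₑ ^ 2 ≤ 2 * ∫⁻ τ : ℝ, F (y + τ • e) := by
    intro y hy
    have hyt : dist y x < t := hy.1
    set I := ∫⁻ τ in Ioo (0 : ℝ) t, ‖fderiv ℝ w (y + τ • e)‖ₑ ^ 2 with hI
    have hmem : ∀ τ ∈ Ioo (0 : ℝ) t, y + τ • e ∈ Ω := fun τ hτ =>
      add_smul_mem_of_mem_closure_epigraph he hγ.continuous h (frontier_subset_closure hy.2) hτ.1
        (by linarith [hτ.2])
    have hvol : volume (Ioo (0 : ℝ) t) = t' := by simp [ht', ENNReal.ofReal]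
    have he' : ‖e‖ₑ = 1 := by rw [← ofReal_norm, he, ENNReal.ofReal_one]
    calc (t' : ℝ≥0∞) * ‖w y - c w‖ₑ ^ 2
        = ∫⁻ τ in Ioo (0 : ℝ) t, ‖w y - c w‖ₑ ^ 2 := by rw [setLIntegral_const, hvol, mul_comm]
      _ ≤ ∫⁻ τ in Ioo (0 : ℝ) t, 2 * (t' * I + ‖w (y + τ • e) - c w‖ₑ ^ 2) := by
          refine setLIntegral_mono' measurableSet_Ioo fun τ hτ => ?_
          refine (enorm_sub_sq_le _ (w (y + τ • e)) _).trans ?_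
          gcongr
          simpa [he', ht', ENNReal.ofReal] using enorm_sub_sq_le_lintegral hw y e hτ.1.le hτ.2.le
      _ = 2 * ((t' : ℝ≥0∞) ^ 2 * I + ∫⁻ τ in Ioo (0 : ℝ) t, ‖w (y + τ • e) - c w‖ₑ ^ 2) := by
          rw [lintegral_const_mul' _ _ (by simp), lintegral_add_left measurable_const,
            setLIntegral_const, hvol]
          ring
      _ = 2 * ∫⁻ τ in Ioo (0 : ℝ) t, F (y + τ • e) := by
          have hm1 : Measurable fun τ : ℝ => (t' : ℝ≥0∞) ^ 2 * ‖fderiv ℝ w (y + τ • e)‖ₑ ^ 2 :=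
            ((hw'.comp (by fun_prop : Continuous fun τ : ℝ => y + τ • e)
              ).enorm.measurable.pow_const 2).const_mul _
          rw [hI, ← lintegral_const_mul' _ _ (by simp), ← lintegral_add_left hm1]
          congr 1
          exact setLIntegral_congr_fun measurableSet_Ioo fun τ hτ => by
            simp [hF, hmem τ hτ]
      _ ≤ 2 * ∫⁻ τ : ℝ, F (y + τ • e) := by
          gcongr
          exact Measure.restrict_le_self
  have hint : (t' : ℝ≥0∞) * ∫⁻ y in S, ‖w y - c w‖ₑ ^ 2 ∂(Measure.euclideanHausdorffMeasure (d - 1))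
      ≤ 2 * (((1 + K : ℝ≥0) : ℝ≥0∞) ^ (d - 1) * (((t' : ℝ≥0∞) ^ 2 + C) * D)) := by
    rw [← lintegral_const_mul' _ _ (by simp)]
    refine (setLIntegral_mono' hSm hpt).trans ?_
    rw [lintegral_const_mul' _ _ (by simp)]
    gcongr
    refine (lintegral_graph_le (by simp; omega) he hγ (fun y hy =>
      inner_eq_of_mem_frontier_epigraph hΩ.isOpen hγ.continuous h hy.2
        (Metric.ball_subset_ball (by linarith) hy.1)) hFm).trans ?_
    gcongr
    rw [hF, lintegral_indicator hΩ.isOpen.measurableSet, lintegral_add_left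
      ((hw'.enorm.measurable.pow_const 2).const_mul _), lintegral_const_mul' _ _ (by simp), add_mul]
    gcongr
    exact hC w hw
  push_cast
  rw [ENNReal.coe_inv ht'0, mul_assoc, mul_comm, ← div_eq_mul_inv,
    ENNReal.le_div_iff_mul_le (by simp [ht'0]) (by simp), mul_comm]
  refine hint.trans_eq ?_
  push_cast
  ring

end IsBoundedLipschitzDomain

end

/-! ### The logarithm of a finite-rank operator and its derivative -/

section

open InnerProductSpace

lemma abs_log_sub_log_le {a b m : ℝ} (hm : 0 < m) (ha : m ≤ a) (hb : m ≤ b) :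
    |Real.log a - Real.log b| ≤ m⁻¹ * |a - b| := by
  have key : ∀ {x y : ℝ}, m ≤ x → m ≤ y → Real.log x - Real.log y ≤ m⁻¹ * |x - y| := by
    intro x y hx hy
    have hx0 := hm.trans_le hx
    have hy0 := hm.trans_le hy
    rw [← Real.log_div hx0.ne' hy0.ne']
    calc Real.log (x / y) ≤ x / y - 1 := Real.log_le_sub_one_of_pos (by positivity)
      _ = y⁻¹ * (x - y) := by field_simp
      _ ≤ y⁻¹ * |x - y| := by gcongr; exact le_abs_self _
      _ ≤ m⁻¹ * |x - y| := by gcongr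
  exact abs_sub_le_iff.2 ⟨key ha hb, by rw [abs_sub_comm]; exact key hb ha⟩

lemma logDivDiff_mul_sub (a b : ℝ) :
    logDivDiff a b * (b - a) = Real.log b - Real.log a := by
  unfold logDivDiff
  split_ifs with h
  · simp [h]
  · have : a - b ≠ 0 := sub_ne_zero.2 h
    field_simp
    ring

lemma abs_logDivDiff_le {a b m : ℝ} (hm : 0 < m) (ha : m ≤ a) (hb : m ≤ b) :
    |logDivDiff a b| ≤ m⁻¹ := by
  have ha0 := hm.trans_le ha
  unfold logDivDiff
  split_ifs with h
  · rw [one_div, abs_of_pos (by positivity)]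
    gcongr
  · rw [abs_div, div_le_iff₀ (abs_pos.2 (sub_ne_zero.2 h))]
    exact abs_log_sub_log_le hm ha hb

lemma continuousAt_logDivDiff {a b : ℝ} (ha : 0 < a) (hb : 0 < b) :
    ContinuousAt (logDivDiff a) b := by
  have h : logDivDiff a = dslope Real.log a := by
    funext x
    unfold logDivDiff
    split_ifs with h
    · rw [← h, dslope_same, Real.deriv_log, one_div]
    · rw [dslope_of_ne _ (Ne.symm h), slope_comm, slope_def_field]
  rw [h]
  by_cases hab : b = a
  · rw [hab, continuousAt_dslope_same]
    exact Real.differentiableAt_log ha.ne'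
  · rw [continuousAt_dslope_of_ne hab]
    exact Real.continuousAt_log hb.ne'

/-- A bounded function that is continuous at `a` varies at most linearly away from `a`, up to an
arbitrarily small error. -/
lemma exists_abs_sub_le_add_mul {f : ℝ → ℝ} {a m M ε : ℝ} (hf : ContinuousAt f a) (hε : 0 < ε)
    (hM : ∀ b, m ≤ b → |f b| ≤ M) (ha : m ≤ a) :
    ∃ C, 0 ≤ C ∧ ∀ b, m ≤ b → |f b - f a| ≤ ε + C * |b - a| := by
  obtain ⟨δ, hδ, h⟩ := Metric.continuousAt_iff.1 hf ε hε
  have hM0 : 0 ≤ M := (abs_nonneg _).trans (hM a ha)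
  refine ⟨2 * M / δ, by positivity, fun b hb => ?_⟩
  by_cases hba : |b - a| < δ
  · have h1 : |f b - f a| < ε := h (by rwa [Real.dist_eq])
    have : 0 ≤ 2 * M / δ * |b - a| := by positivity
    linarith
  · have h1 : |f b - f a| ≤ 2 * M := by
      have := abs_sub (f b) (f a)
      linarith [hM a ha, hM b hb]
    have h2 : 2 * M ≤ 2 * M / δ * |b - a| := by
      rw [div_mul_eq_mul_div, le_div_iff₀ hδ]
      exact mul_le_mul_of_nonneg_left (not_lt.1 hba) (by positivity)
    linarith

section Hilbert

variable {H : Type*} [NormedAddCommGroup H] [InnerProductSpace ℂ H] {n : ℕ}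

/-- By counting dimensions, `n` orthonormal vectors in the span of `n` orthonormal vectors form a
basis of it. -/
lemma sum_inner_smul_eq_of_mem_span {ψ φ : Fin n → H} (hψ : Orthonormal ℂ ψ)
    (hφ : Orthonormal ℂ φ) (hmem : ∀ k, φ k ∈ Submodule.span ℂ (Set.range ψ)) {v : H}
    (hv : v ∈ Submodule.span ℂ (Set.range ψ)) : ∑ k, inner ℂ (φ k) v • φ k = v := by
  have hspan : Submodule.span ℂ (Set.range φ) = Submodule.span ℂ (Set.range ψ) := by
    have := FiniteDimensional.span_of_finite ℂ (Set.finite_range ψ)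
    refine Submodule.eq_of_le_of_finrank_eq
      (Submodule.span_le.2 (Set.range_subset_iff.2 hmem)) ?_
    rw [finrank_span_eq_card hφ.linearIndependent, finrank_span_eq_card hψ.linearIndependent]
  rw [← hspan] at hv
  obtain ⟨c, rfl⟩ := (Submodule.mem_span_range_iff_exists_fun ℂ).1 hv
  simp [hφ.inner_right_fintype]

lemma proj_apply (ψ : Fin n → H) (f : H) : proj ψ f = ∑ k, inner ℂ (ψ k) f • ψ k := by
  simp [proj]

lemma proj_mem_span (ψ : Fin n → H) (f : H) : proj ψ f ∈ Submodule.span ℂ (Set.range ψ) := by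
  rw [proj_apply]
  exact Submodule.sum_mem _ fun k _ =>
    Submodule.smul_mem _ _ (Submodule.subset_span (Set.mem_range_self k))

lemma proj_eq_self {ψ : Fin n → H} (hψ : Orthonormal ℂ ψ) {v : H}
    (hv : v ∈ Submodule.span ℂ (Set.range ψ)) : proj ψ v = v := by
  rw [proj_apply]
  exact sum_inner_smul_eq_of_mem_span hψ hψ
    (fun k => Submodule.subset_span (Set.mem_range_self k)) hv

lemma inner_proj_left (ψ : Fin n → H) (f g : H) :
    inner ℂ (proj ψ f) g = inner ℂ f (proj ψ g) := by
  simp only [proj_apply, sum_inner, inner_sum, inner_smul_left, inner_smul_right, inner_conj_symm]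
  exact Finset.sum_congr rfl fun k _ => mul_comm _ _

lemma proj_apply_of_orthonormal {ψ φ : Fin n → H} (hψ : Orthonormal ℂ ψ)
    (hφ : Orthonormal ℂ φ) (hmem : ∀ k, φ k ∈ Submodule.span ℂ (Set.range ψ)) (f : H) :
    proj ψ f = ∑ k, inner ℂ (φ k) f • φ k := by
  rw [← sum_inner_smul_eq_of_mem_span hψ hφ hmem (proj_mem_span ψ f)]
  refine Finset.sum_congr rfl fun k _ => ?_
  rw [← inner_proj_left, proj_eq_self hψ (hmem k)]

/-- Compressions of positive definite symmetric operators have positive eigensystems. -/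
lemma exists_isSpectralRep {ψ : Fin n → H} (hψ : Orthonormal ℂ ψ) {A : H →L[ℂ] H}
    (hA : (A : H →ₗ[ℂ] H).IsSymmetric) (hpos : ∀ x, x ≠ 0 → 0 < (inner ℂ x (A x)).re) :
    ∃ (μ : Fin n → ℝ) (φ : Fin n → H), IsSpectralRep ψ (proj ψ ∘L A ∘L proj ψ) μ φ := by
  set U := Submodule.span ℂ (Set.range ψ) with hU
  have : FiniteDimensional ℂ U := FiniteDimensional.span_of_finite ℂ (Set.finite_range ψ)
  have hrank : Module.finrank ℂ U = n := by
    rw [hU, finrank_span_eq_card hψ.linearIndependent, Fintype.card_fin]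
  let B : U →ₗ[ℂ] U := ((proj ψ ∘L A : H →L[ℂ] H) : H →ₗ[ℂ] H).restrict
    (fun x _ => proj_mem_span ψ (A x))
  have hB : B.IsSymmetric := fun x y => by
    change inner ℂ (proj ψ (A x)) (y : H) = inner ℂ (x : H) (proj ψ (A y))
    rw [inner_proj_left, proj_eq_self hψ y.2, ← inner_proj_left, proj_eq_self hψ x.2]
    exact hA x y
  have hφ : Orthonormal ℂ fun k => (hB.eigenvectorBasis hrank k : H) :=
    (hB.eigenvectorBasis hrank).orthonormal.comp_linearIsometry U.subtypeₗᵢ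
  have heig : ∀ k, proj ψ (A (hB.eigenvectorBasis hrank k)) =
      (hB.eigenvalues hrank k : ℂ) • (hB.eigenvectorBasis hrank k : H) := fun k =>
    congrArg Subtype.val (hB.apply_eigenvectorBasis hrank k)
  refine ⟨hB.eigenvalues hrank, fun k => hB.eigenvectorBasis hrank k, ?_, hφ,
    fun k => (hB.eigenvectorBasis hrank k).2, fun f => ?_⟩
  · intro k
    have h0 : (hB.eigenvectorBasis hrank k : H) ≠ 0 := hφ.ne_zero k
    have h1 := hpos _ h0
    have hn : ‖(hB.eigenvectorBasis hrank k : H)‖ = 1 := hφ.1 k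
    have h2 : inner ℂ (hB.eigenvectorBasis hrank k : H) (A (hB.eigenvectorBasis hrank k)) =
        (hB.eigenvalues hrank k : ℂ) := by
      rw [← proj_eq_self hψ (hB.eigenvectorBasis hrank k).2, inner_proj_left,
        proj_eq_self hψ (hB.eigenvectorBasis hrank k).2, heig, inner_smul_right,
        inner_self_eq_norm_sq_to_K, hn]
      simp
    rwa [h2, Complex.ofReal_re] at h1
  · rw [ContinuousLinearMap.comp_apply, ContinuousLinearMap.comp_apply,
      proj_apply_of_orthonormal hψ hφ (fun k => (hB.eigenvectorBasis hrank k).2) f]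
    simp only [map_sum, map_smul, heig, smul_smul]
    exact Finset.sum_congr rfl fun k _ => by rw [mul_comm]

/-- The operator `f ↦ ∑ₖ g(μₖ) (f, φₖ) φₖ`. -/
def spectralFun (g : ℝ → ℝ) (μ : Fin n → ℝ) (φ : Fin n → H) : H →L[ℂ] H :=
  ∑ k, (g (μ k) : ℂ) • rankOne ℂ (φ k) (φ k)

/-- Expand `φ' l` in the basis `φ` in one operator and `φ j` in the basis `φ'` in the other. Every
pair of eigenvalues is compared, so eigenvectors need not be matched and multiplicities do not
matter. -/
lemma spectralFun_sub_spectralFun {ψ φ φ' : Fin n → H} (hψ : Orthonormal ℂ ψ)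
    (hφ : Orthonormal ℂ φ) (hmem : ∀ k, φ k ∈ Submodule.span ℂ (Set.range ψ))
    (hφ' : Orthonormal ℂ φ') (hmem' : ∀ k, φ' k ∈ Submodule.span ℂ (Set.range ψ))
    (g : ℝ → ℝ) (μ μ' : Fin n → ℝ) :
    spectralFun g μ' φ' - spectralFun g μ φ =
      ∑ j, ∑ l, (((g (μ' l) - g (μ j) : ℝ) : ℂ) * inner ℂ (φ j) (φ' l)) •
        rankOne ℂ (φ j) (φ' l) := by
  have h1 : spectralFun g μ' φ' =
      ∑ j, ∑ l, ((g (μ' l) : ℂ) * inner ℂ (φ j) (φ' l)) • rankOne ℂ (φ j) (φ' l) := by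
    rw [Finset.sum_comm]
    refine Finset.sum_congr rfl fun l _ => ?_
    ext f
    have h : inner ℂ (φ' l) f • φ' l =
        ∑ j, inner ℂ (φ' l) f • inner ℂ (φ j) (φ' l) • φ j := by
      rw [← Finset.smul_sum, sum_inner_smul_eq_of_mem_span hψ hφ hmem (hmem' l)]
    simp only [smul_apply, rankOne_apply, sum_apply, h, Finset.smul_sum, smul_smul]
    exact Finset.sum_congr rfl fun j _ => by ring_nf
  have h2 : spectralFun g μ φ =
      ∑ j, ∑ l, ((g (μ j) : ℂ) * inner ℂ (φ j) (φ' l)) • rankOne ℂ (φ j) (φ' l) := by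
    refine Finset.sum_congr rfl fun j _ => ?_
    ext f
    have h : inner ℂ (φ j) f = ∑ l, inner ℂ (φ j) (φ' l) * inner ℂ (φ' l) f := by
      conv_lhs => rw [← sum_inner_smul_eq_of_mem_span hψ hφ' hmem' (hmem j)]
      simp only [sum_inner, inner_smul_left, inner_conj_symm]
    simp only [smul_apply, rankOne_apply, sum_apply, h,
      smul_smul, ← Finset.sum_smul, Finset.mul_sum, mul_assoc]
  rw [h1, h2, ← Finset.sum_sub_distrib]
  refine Finset.sum_congr rfl fun j _ => ?_
  rw [← Finset.sum_sub_distrib]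
  refine Finset.sum_congr rfl fun l _ => ?_
  rw [← sub_smul]
  push_cast
  ring_nf

namespace IsSpectralRep

variable {ψ : Fin n → H} {T T' : H →L[ℂ] H} {μ μ' : Fin n → ℝ} {φ φ' : Fin n → H}

lemma apply_eigenvector (h : IsSpectralRep ψ T μ φ) (k : Fin n) : T (φ k) = (μ k : ℂ) • φ k := by
  rw [h.apply_eq, Finset.sum_eq_single k]
  · simp [h.orthonormal.1 k]
  · intro j _ hj
    simp [h.orthonormal.2 hj]
  · simp

lemma inner_apply_eigenvector (h : IsSpectralRep ψ T μ φ) (k : Fin n) (f : H) :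
    inner ℂ (φ k) (T f) = μ k * inner ℂ (φ k) f := by
  rw [h.apply_eq, h.orthonormal.inner_right_fintype]

/-- Let `T` act to the left on `φ j` and `T'` to the right on `φ' l`. A difference of eigenvalues is
thus traded for `T' - T`. -/
lemma sub_mul_inner_eq (h : IsSpectralRep ψ T μ φ) (h' : IsSpectralRep ψ T' μ' φ')
    (j l : Fin n) : ((μ' l - μ j : ℝ) : ℂ) * inner ℂ (φ j) (φ' l) =
      inner ℂ (φ j) ((T' - T) (φ' l)) := by
  rw [sub_apply, inner_sub_right, h.inner_apply_eigenvector,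
    h'.apply_eigenvector, inner_smul_right]
  push_cast
  ring

lemma abs_sub_mul_norm_inner_le (h : IsSpectralRep ψ T μ φ) (h' : IsSpectralRep ψ T' μ' φ')
    (j l : Fin n) : |μ' l - μ j| * ‖inner ℂ (φ j) (φ' l)‖ ≤ ‖T' - T‖ := by
  rw [← Real.norm_eq_abs, ← Complex.norm_real, ← norm_mul, h.sub_mul_inner_eq h']
  refine (norm_inner_le_norm _ _).trans ?_
  rw [h.orthonormal.1, one_mul]
  refine ((T' - T).le_opNorm _).trans ?_
  rw [h'.orthonormal.1, mul_one]

lemma norm_inner_le_one (h : IsSpectralRep ψ T μ φ) (h' : IsSpectralRep ψ T' μ' φ')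
    (j l : Fin n) : ‖inner ℂ (φ j) (φ' l)‖ ≤ 1 := by
  refine (norm_inner_le_norm _ _).trans ?_
  rw [h.orthonormal.1, h'.orthonormal.1, one_mul]

/-- `⟨φ' l, T (φ' l)⟩` is a convex combination of the `μ k`, hence at least `m`, and it differs from
`μ' l` by at most `‖T' - T‖`. -/
lemma sub_norm_sub_le (hψ : Orthonormal ℂ ψ) (h : IsSpectralRep ψ T μ φ)
    (h' : IsSpectralRep ψ T' μ' φ') {m : ℝ} (hm : ∀ k, m ≤ μ k) (l : Fin n) :
    m - ‖T' - T‖ ≤ μ' l := by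
  have hexp := sum_inner_smul_eq_of_mem_span hψ h.orthonormal h.mem_span (h'.mem_span l)
  have hnorm : ∀ x : H, inner ℂ (φ' l) x = ∑ k, inner ℂ (φ' l) (φ k) * inner ℂ (φ k) x := by
    intro x
    conv_lhs => rw [← hexp]
    simp only [sum_inner, inner_smul_left, inner_conj_symm]
  have h1 : ∑ k, ‖inner ℂ (φ k) (φ' l)‖ ^ 2 = 1 := by
    have := hnorm (φ' l)
    rw [inner_self_eq_norm_sq_to_K, h'.orthonormal.1] at this
    have h2 := congrArg Complex.re this
    simp only [map_one, Complex.re_sum, ← inner_conj_symm (φ' l), Complex.conj_mul'] at h2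
    norm_cast at h2
    simpa using h2.symm
  have h2 : inner ℂ (φ' l) (T (φ' l)) = ((∑ k, μ k * ‖inner ℂ (φ k) (φ' l)‖ ^ 2 : ℝ) : ℂ) := by
    rw [hnorm]
    push_cast
    refine Finset.sum_congr rfl fun k _ => ?_
    rw [h.inner_apply_eigenvector, ← inner_conj_symm (φ' l), mul_left_comm, Complex.conj_mul']
  have h3 : inner ℂ (φ' l) (T' (φ' l)) = (μ' l : ℂ) := by
    rw [h'.inner_apply_eigenvector, inner_self_eq_norm_sq_to_K, h'.orthonormal.1]
    simp
  have h4 : m ≤ ∑ k, μ k * ‖inner ℂ (φ k) (φ' l)‖ ^ 2 := by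
    calc m = ∑ k, m * ‖inner ℂ (φ k) (φ' l)‖ ^ 2 := by rw [← Finset.mul_sum, h1, mul_one]
      _ ≤ _ := Finset.sum_le_sum fun k _ => by gcongr; exact hm k
  have h5 : |μ' l - ∑ k, μ k * ‖inner ℂ (φ k) (φ' l)‖ ^ 2| ≤ ‖T' - T‖ := by
    rw [← Real.norm_eq_abs, ← Complex.norm_real, Complex.ofReal_sub, ← h2, ← h3, ← inner_sub_right,
      ← sub_apply]
    refine (norm_inner_le_norm _ _).trans ?_
    rw [h'.orthonormal.1, one_mul]
    refine ((T' - T).le_opNorm _).trans ?_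
    rw [h'.orthonormal.1, mul_one]
  linarith [(abs_le.1 h5).1]

/-- In each of the `n ^ 2` terms the factor `|μ' l - μ j|` is absorbed by the inner product of the
eigenvectors, which leaves `‖T' - T‖`. No Lipschitz condition on `g` is needed, only one up to the
error `ε`. -/
lemma norm_spectralFun_sub_le (hψ : Orthonormal ℂ ψ) (h : IsSpectralRep ψ T μ φ)
    (h' : IsSpectralRep ψ T' μ' φ') {g : ℝ → ℝ} {ε C : ℝ} (hε : 0 ≤ ε) (hC : 0 ≤ C)
    (hg : ∀ j l, |g (μ' l) - g (μ j)| ≤ ε + C * |μ' l - μ j|) :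
    ‖spectralFun g μ' φ' - spectralFun g μ φ‖ ≤ n ^ 2 * (ε + C * ‖T' - T‖) := by
  rw [spectralFun_sub_spectralFun hψ h.orthonormal h.mem_span h'.orthonormal h'.mem_span]
  calc _ ≤ ∑ j : Fin n, ∑ l : Fin n, (ε + C * ‖T' - T‖) := by
        refine norm_sum_le_of_le _ fun j _ => norm_sum_le_of_le _ fun l _ => ?_
        rw [norm_smul, norm_rankOne, h.orthonormal.1, h'.orthonormal.1, one_mul, mul_one,
          norm_mul, Complex.norm_real, Real.norm_eq_abs]
        calc _ ≤ (ε + C * |μ' l - μ j|) * ‖inner ℂ (φ j) (φ' l)‖ := by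
              gcongr; exact hg j l
          _ = ε * ‖inner ℂ (φ j) (φ' l)‖ + C * (|μ' l - μ j| * ‖inner ℂ (φ j) (φ' l)‖) := by ring
          _ ≤ ε * 1 + C * ‖T' - T‖ := by
              gcongr
              · exact h.norm_inner_le_one h' j l
              · exact h.abs_sub_mul_norm_inner_le h' j l
          _ = _ := by ring
    _ = _ := by
        simp only [Finset.sum_const, Finset.card_univ, Fintype.card_fin, nsmul_eq_mul]
        ring

/-- An exact formula, without remainder: `T'` enters the last factor only, so differentiability at
`T` reduces to continuity of that factor. -/
lemma spectralFun_log_sub (hψ : Orthonormal ℂ ψ) (h : IsSpectralRep ψ T μ φ)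
    (h' : IsSpectralRep ψ T' μ' φ') :
    spectralFun Real.log μ' φ' - spectralFun Real.log μ φ =
      ∑ j, rankOne ℂ (φ j) (φ j) ∘L (T' - T) ∘L spectralFun (logDivDiff (μ j)) μ' φ' := by
  rw [spectralFun_sub_spectralFun hψ h.orthonormal h.mem_span h'.orthonormal h'.mem_span]
  refine Finset.sum_congr rfl fun j _ => ?_
  ext f
  simp only [spectralFun, sum_apply, smul_apply,
    ContinuousLinearMap.comp_apply, rankOne_apply, map_sum, map_smul, smul_smul]
  refine Finset.sum_congr rfl fun l _ => ?_
  rw [← logDivDiff_mul_sub, ← h.sub_mul_inner_eq h' j l]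
  push_cast
  ring_nf

lemma spectralLog_eq (hψ : Orthonormal ℂ ψ) (h : IsSpectralRep ψ T μ φ) :
    spectralLog ψ T = spectralFun Real.log μ φ := by
  have hex : ∃ p : (Fin n → ℝ) × (Fin n → H), IsSpectralRep ψ T p.1 p.2 := ⟨(μ, φ), h⟩
  rw [spectralLog, dif_pos hex]
  change spectralFun Real.log hex.choose.1 hex.choose.2 = _
  -- Both eigensystems belong to `T`, so the middle factor `T - T` vanishes.
  rw [← sub_eq_zero, h.spectralFun_log_sub hψ hex.choose_spec]
  simp

end IsSpectralRep

variable (μ : Fin n → ℝ) (φ : Fin n → H)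

/-- The derivative of the logarithm at an operator with eigensystem `{μₖ, φₖ}`. -/
def spectralLogDeriv : (H →L[ℂ] H) →L[ℝ] (H →L[ℂ] H) :=
  ∑ j, ∑ k, logDivDiff (μ j) (μ k) •
    ((ContinuousLinearMap.compL ℂ H H H (rankOne ℂ (φ j) (φ j))).comp
      ((ContinuousLinearMap.compL ℂ H H H).flip (rankOne ℂ (φ k) (φ k)))).restrictScalars ℝ

lemma spectralLogDeriv_apply_apply (S : H →L[ℂ] H) (f : H) :
    spectralLogDeriv μ φ S f = ∑ j, ∑ k, ((logDivDiff (μ j) (μ k) : ℂ) * inner ℂ (φ k) f *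
      inner ℂ (φ j) (S (φ k))) • φ j := by
  simp only [spectralLogDeriv, sum_apply, smul_apply]
  refine Finset.sum_congr rfl fun j _ => Finset.sum_congr rfl fun k _ => ?_
  rw [mul_assoc, ← smul_smul, Complex.coe_smul]
  simp [smul_smul]

lemma spectralLogDeriv_apply (S : H →L[ℂ] H) :
    spectralLogDeriv μ φ S =
      ∑ j, rankOne ℂ (φ j) (φ j) ∘L S ∘L spectralFun (logDivDiff (μ j)) μ φ := by
  ext f
  rw [spectralLogDeriv_apply_apply]
  simp only [spectralFun, sum_apply, smul_apply,
    ContinuousLinearMap.comp_apply, rankOne_apply, map_sum, map_smul, mul_assoc, smul_smul]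

variable {μ φ}

/-- The Daleckii-Krein formula for the logarithm. -/
lemma IsSpectralRep.hasFDerivWithinAt_spectralLog {ψ : Fin n → H} (hψ : Orthonormal ℂ ψ)
    {T : H →L[ℂ] H} (h : IsSpectralRep ψ T μ φ) :
    HasFDerivWithinAt (𝕜 := ℝ) (spectralLog ψ) (spectralLogDeriv μ φ)
      {T' | ∃ μ' φ', IsSpectralRep ψ T' μ' φ'} T := by
  rw [hasFDerivWithinAt_iff_isLittleO, Asymptotics.isLittleO_iff]
  intro ε hε
  obtain ⟨m, hm0, hm⟩ : ∃ m > 0, ∀ k, m ≤ μ k := by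
    rcases n.eq_zero_or_pos with rfl | hn
    · exact ⟨1, one_pos, fun k => k.elim0⟩
    · have : Nonempty (Fin n) := ⟨⟨0, hn⟩⟩
      obtain ⟨k, hk⟩ := Finite.exists_min μ
      exact ⟨μ k, h.pos k, hk⟩
  -- The final estimate is `2 * n ^ 3 * ε' * ‖T' - T‖`: there are `n` summands, each with `n ^ 2`
  -- pairs of eigenvalues and an error `2 * ε'` per pair.
  set ε' := ε / (2 * (n ^ 3 + 1)) with hε'
  have hε'0 : 0 < ε' := by positivity
  have hex : ∀ j k, ∃ C, 0 ≤ C ∧ ∀ b, m / 2 ≤ b →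
      |logDivDiff (μ j) b - logDivDiff (μ j) (μ k)| ≤ ε' + C * |b - μ k| := fun j k =>
    exists_abs_sub_le_add_mul (continuousAt_logDivDiff (h.pos j) (h.pos k)) hε'0
      (fun b hb => abs_logDivDiff_le (half_pos hm0) (by linarith [hm j]) hb) (by linarith [hm k])
  choose C hC0 hC using hex
  set D := ∑ j, ∑ k, C j k with hD
  have hD0 : 0 ≤ D := Finset.sum_nonneg fun j _ => Finset.sum_nonneg fun k _ => hC0 j k
  have hCD : ∀ j k, C j k ≤ D := fun j k =>
    (Finset.single_le_sum (fun k _ => hC0 j k) (Finset.mem_univ k)).trans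
      (Finset.single_le_sum (f := fun j => ∑ k, C j k)
        (fun j _ => Finset.sum_nonneg fun k _ => hC0 j k) (Finset.mem_univ j))
  -- The first bound keeps the eigenvalues of `T'` above `m / 2`, the second makes `D * ‖T' - T‖` at
  -- most `ε'`.
  set δ := min (m / 2) (ε' / (D + 1)) with hδ
  have hδ0 : 0 < δ := by positivity
  filter_upwards [mem_nhdsWithin_of_mem_nhds (Metric.ball_mem_nhds T hδ0), self_mem_nhdsWithin]
    with T' hT' ⟨μ', φ', h'⟩
  have hTT : ‖T' - T‖ < δ := by rwa [← dist_eq_norm]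
  have hlow : ∀ l, m / 2 ≤ μ' l := fun l => by
    have := h.sub_norm_sub_le hψ h' hm l
    have := hTT.trans_le (min_le_left _ _)
    linarith
  have hD' : D * ‖T' - T‖ ≤ ε' := by
    have h1 := hTT.le.trans (min_le_right _ _)
    rw [le_div_iff₀ (by positivity)] at h1
    nlinarith [norm_nonneg (T' - T)]
  have hbound : ∀ j, ‖spectralFun (logDivDiff (μ j)) μ' φ' - spectralFun (logDivDiff (μ j)) μ φ‖
      ≤ n ^ 2 * (2 * ε') := fun j => by
    refine (h.norm_spectralFun_sub_le hψ h' hε'0.le hD0 fun k l => ?_).trans ?_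
    · refine (hC j k _ (hlow l)).trans ?_
      gcongr
      exact hCD j k
    · gcongr
      linarith
  rw [h.spectralLog_eq hψ, h'.spectralLog_eq hψ, h.spectralFun_log_sub hψ h',
    spectralLogDeriv_apply, ← Finset.sum_sub_distrib]
  calc _ ≤ ∑ j : Fin n, ‖T' - T‖ * (n ^ 2 * (2 * ε')) := by
        refine norm_sum_le_of_le _ fun j _ => ?_
        rw [← ContinuousLinearMap.comp_sub, ← ContinuousLinearMap.comp_sub]
        refine (ContinuousLinearMap.opNorm_comp_le _ _).trans ?_
        rw [norm_rankOne, h.orthonormal.1, one_mul, one_mul]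
        refine (ContinuousLinearMap.opNorm_comp_le _ _).trans ?_
        gcongr
        exact hbound j
    _ = (2 * n ^ 3 * ε') * ‖T' - T‖ := by
        simp only [Finset.sum_const, Finset.card_univ, Fintype.card_fin, nsmul_eq_mul]
        ring
    _ ≤ ε * ‖T' - T‖ := by
        gcongr
        rw [hε', mul_div_assoc', div_le_iff₀ (by positivity)]
        nlinarith [hε.le]

section Compression

variable {B : Type*} [NormedAddCommGroup B] [NormedSpace ℝ B] {N : B → H →L[ℂ] H}
  {N' : B →L[ℝ] (H →L[ℂ] H)} {σ : B} {ψ : Fin n → H}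

lemma spectralFun_apply (g : ℝ → ℝ) (f : H) :
    spectralFun g μ φ f = ∑ k, ((g (μ k) : ℂ) * inner ℂ (φ k) f) • φ k := by
  simp only [spectralFun, sum_apply, smul_apply, rankOne_apply, smul_smul]

lemma spectralLogDeriv_proj (hψ : Orthonormal ℂ ψ)
    (hmem : ∀ k, φ k ∈ Submodule.span ℂ (Set.range ψ)) (S : H →L[ℂ] H) :
    spectralLogDeriv μ φ (proj ψ ∘L S ∘L proj ψ) = spectralLogDeriv μ φ S := by
  ext f
  simp only [spectralLogDeriv_apply_apply, ContinuousLinearMap.comp_apply, ← inner_proj_left,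
    proj_eq_self hψ (hmem _)]

/-- The logarithm is differentiable only within the set of operators with an eigensystem; the chain
rule applies since the compressions stay in this set near `σ`. -/
lemma IsSpectralRep.hasFDerivAt_spectralLog_compression (hψ : Orthonormal ℂ ψ)
    (hN : HasFDerivAt N N' σ)
    (hex : ∀ᶠ τ in 𝓝 σ, ∃ μ φ, IsSpectralRep ψ (proj ψ ∘L N τ ∘L proj ψ) μ φ)
    (h : IsSpectralRep ψ (proj ψ ∘L N σ ∘L proj ψ) μ φ) :
    HasFDerivAt (fun τ => spectralLog ψ (proj ψ ∘L N τ ∘L proj ψ))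
      ((spectralLogDeriv μ φ).comp N') σ := by
  have hc : HasFDerivAt (fun τ => proj ψ ∘L N τ ∘L proj ψ) _ σ :=
    (((ContinuousLinearMap.compL ℂ H H H (proj ψ)).comp
      ((ContinuousLinearMap.compL ℂ H H H).flip (proj ψ))).restrictScalars ℝ).hasFDerivAt.comp σ hN
  refine ((h.hasFDerivWithinAt_spectralLog hψ).comp_hasFDerivAt σ hc hex).congr_fderiv ?_
  ext1 η
  exact spectralLogDeriv_proj hψ h.mem_span (N' η)

lemma IsSpectralRep.fderiv_spectralLog_compression (hψ : Orthonormal ℂ ψ)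
    (hN : DifferentiableAt ℝ N σ)
    (hex : ∀ᶠ τ in 𝓝 σ, ∃ μ φ, IsSpectralRep ψ (proj ψ ∘L N τ ∘L proj ψ) μ φ)
    (h : IsSpectralRep ψ (proj ψ ∘L N σ ∘L proj ψ) μ φ) (η : B) (f : H) :
    fderiv ℝ (fun τ => spectralLog ψ (proj ψ ∘L N τ ∘L proj ψ)) σ η f =
      ∑ j, ∑ k, ((logDivDiff (μ j) (μ k) : ℂ) * inner ℂ (φ k) f *
        inner ℂ (φ j) (fderiv ℝ N σ η (φ k))) • φ j := by
  rw [(h.hasFDerivAt_spectralLog_compression hψ hN.hasFDerivAt hex).fderiv]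
  exact spectralLogDeriv_apply_apply μ φ _ f

end Compression

end Hilbert

end

/-! ### The abstract variational problem -/

section

section Abstract

open ContinuousLinearMap

variable {V G K : Type*} [NormedAddCommGroup V] [InnerProductSpace ℂ V] [CompleteSpace V]
  [NormedAddCommGroup G] [InnerProductSpace ℂ G] [CompleteSpace G]
  [NormedAddCommGroup K] [InnerProductSpace ℂ K] [CompleteSpace K]

/-- The operator of the sesquilinear form `(v, w) ↦ (m (grad v), grad w)`. -/
def formOp (grad : V →L[ℂ] G) (m : G →L[ℂ] G) : V →L[ℂ] V := adjoint grad ∘L m ∘L grad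

/-- The operator that maps a functional `f` on the space of traces to the trace of the solution of
the variational problem with coefficient `m` and right-hand side `f`. -/
def solutionOp (grad : V →L[ℂ] G) (tr : V →L[ℂ] K) (m : G →L[ℂ] G) : K →L[ℂ] K :=
  tr ∘L Ring.inverse (formOp grad m) ∘L adjoint tr

/-- Positive operators that are bounded from below. -/
structure IsElliptic (m : G →L[ℂ] G) : Prop where
  isSymmetric : (m : G →ₗ[ℂ] G).IsSymmetric
  bound : ∃ a : ℝ, 0 < a ∧ ∀ g, a * ‖g‖ ^ 2 ≤ (inner ℂ g (m g)).re

variable {grad : V →L[ℂ] G} {tr : V →L[ℂ] K} {m : G →L[ℂ] G}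

lemma inner_formOp (v w : V) : inner ℂ v (formOp grad m w) = inner ℂ (grad v) (m (grad w)) := by
  simp only [formOp, comp_apply, adjoint_inner_right]

/-- Lax-Milgram: the form is coercive with constant `a * c ^ 2`. -/
lemma IsElliptic.isUnit_formOp (hm : IsElliptic m) {c : ℝ} (hc : 0 < c)
    (hgrad : ∀ v, c * ‖v‖ ≤ ‖grad v‖) : IsUnit (formOp grad m) := by
  obtain ⟨a, ha, hb⟩ := hm.bound
  refine isUnit_of_forall_le_norm_inner_map _ (c := (a * c ^ 2).toNNReal)
    (Real.toNNReal_pos.2 (by positivity)) fun v => ?_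
  rw [norm_inner_symm, inner_formOp]
  refine le_trans ?_ (Complex.re_le_norm _)
  refine le_trans ?_ (hb (grad v))
  rw [Real.coe_toNNReal _ (by positivity)]
  calc ‖v‖ ^ 2 * (a * c ^ 2) = a * (c * ‖v‖) ^ 2 := by ring
    _ ≤ a * ‖grad v‖ ^ 2 := by gcongr; exact hgrad v

lemma inner_grad_inverse_formOp (hu : IsUnit (formOp grad m)) (f : K) (v : V) :
    inner ℂ (grad v) (m (grad (Ring.inverse (formOp grad m) (adjoint tr f)))) =
      inner ℂ (tr v) f := by
  have h : formOp grad m (Ring.inverse (formOp grad m) (adjoint tr f)) = adjoint tr f :=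
    congrArg (fun T : V →L[ℂ] V => T (adjoint tr f)) (Ring.mul_inverse_cancel _ hu)
  rw [← inner_formOp, h, adjoint_inner_right]

lemma inner_solutionOp_eq_energy (hu : IsUnit (formOp grad m)) (f g : K) :
    inner ℂ (solutionOp grad tr m g) f =
      inner ℂ (grad (Ring.inverse (formOp grad m) (adjoint tr g)))
        (m (grad (Ring.inverse (formOp grad m) (adjoint tr f)))) := by
  rw [inner_grad_inverse_formOp hu]
  rfl

lemma IsElliptic.isSymmetric_solutionOp (hm : IsElliptic m) (hu : IsUnit (formOp grad m)) :
    (solutionOp grad tr m : K →ₗ[ℂ] K).IsSymmetric := fun g f => by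
  rw [coe_coe, inner_solutionOp_eq_energy hu, ← inner_conj_symm g,
    inner_solutionOp_eq_energy hu, inner_conj_symm]
  exact (hm.isSymmetric _ _).symm

/-- The quadratic form is the energy of the solution. If the energy vanished, `f` would be
orthogonal to all traces, and these are dense. -/
lemma IsElliptic.inner_solutionOp_pos (hm : IsElliptic m) (hu : IsUnit (formOp grad m))
    (htr : DenseRange tr) {f : K} (hf : f ≠ 0) :
    0 < (inner ℂ f (solutionOp grad tr m f)).re := by
  obtain ⟨a, ha, hb⟩ := hm.bound
  set v := Ring.inverse (formOp grad m) (adjoint tr f) with hv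
  have hgv : grad v ≠ 0 := fun h0 => hf <| by
    refine htr.eq_zero_of_inner_right (𝕜 := ℂ) ?_
    intro w
    rw [← inner_grad_inverse_formOp hu, ← hv, h0, map_zero, inner_zero_right]
  rw [← inner_conj_symm, inner_solutionOp_eq_energy hu, Complex.conj_re]
  refine lt_of_lt_of_le ?_ (hb _)
  have : 0 < ‖grad v‖ := norm_pos_iff.2 hgv
  positivity

/-- The variational problem is solvable if `grad` is bounded from below. -/
lemma IsElliptic.exists_solution (hm : IsElliptic m) {c : ℝ} (hc : 0 < c)
    (hgrad : ∀ v, c * ‖v‖ ≤ ‖grad v‖) (tr : V →L[ℂ] K) (f : K) :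
    ∃ v : V, solutionOp grad tr m f = tr v ∧
      ∀ w, inner ℂ (grad w) (m (grad v)) = inner ℂ (tr w) f :=
  ⟨_, rfl, inner_grad_inverse_formOp (hm.isUnit_formOp hc hgrad) f⟩

lemma IsElliptic.exists_isSpectralRep_solutionOp {n : ℕ} {ψ : Fin n → K} (hψ : Orthonormal ℂ ψ)
    (hm : IsElliptic m) {c : ℝ} (hc : 0 < c) (hgrad : ∀ v, c * ‖v‖ ≤ ‖grad v‖)
    (htr : DenseRange tr) :
    ∃ (μ : Fin n → ℝ) (φ : Fin n → K),
      IsSpectralRep ψ (proj ψ ∘L solutionOp grad tr m ∘L proj ψ) μ φ :=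
  have hu := hm.isUnit_formOp hc hgrad
  exists_isSpectralRep hψ (hm.isSymmetric_solutionOp hu) fun _ hf =>
    hm.inner_solutionOp_pos hu htr hf

lemma differentiableAt_solutionOp {B : Type*} [NormedAddCommGroup B] [NormedSpace ℝ B]
    {M : B → G →L[ℂ] G} {σ : B} (hM : DifferentiableAt ℝ M σ)
    (hu : IsUnit (formOp grad (M σ))) :
    DifferentiableAt ℝ (fun σ => solutionOp grad tr (M σ)) σ := by
  have hform : DifferentiableAt ℝ (fun σ => formOp grad (M σ)) σ :=
    ((((compL ℂ V G V (adjoint grad)).comp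
      ((compL ℂ V G G).flip grad)).restrictScalars ℝ).differentiableAt).comp σ hM
  have hinv : DifferentiableAt ℝ (fun σ => Ring.inverse (formOp grad (M σ))) σ :=
    DifferentiableAt.comp (g := Ring.inverse) σ (differentiableAt_inverse (𝕜 := ℝ) hu) hform
  exact ((((compL ℂ K V K tr).comp
      ((compL ℂ K V V).flip (adjoint tr))).restrictScalars ℝ).differentiableAt).comp σ hinv

end Abstract

end

/-! ### `H¹` functions with traces as a closed subspace of triples -/

section

section General

lemma enorm_Lp_two_sq {α F : Type*} [MeasurableSpace α] {μ : Measure α} [NormedAddCommGroup F]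
    (u : Lp F 2 μ) : ‖u‖ₑ ^ 2 = ∫⁻ x, ‖u x‖ₑ ^ 2 ∂μ := by
  have h := eLpNorm_nnreal_pow_eq_lintegral (μ := μ) (f := u) (p := 2) two_ne_zero
  rw [Lp.enorm_def]
  simpa only [ENNReal.coe_ofNat, NNReal.coe_ofNat, ENNReal.rpow_two] using h

lemma continuous_integral_inner {α F : Type*} [MeasurableSpace α] {μ : Measure α}
    [NormedAddCommGroup F] [InnerProductSpace ℂ F] {h : α → F} (hh : MemLp h 2 μ) :
    Continuous fun u : Lp F 2 μ => ∫ x, inner ℂ (h x) (u x) ∂μ := by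
  have heq : (fun u : Lp F 2 μ => ∫ x, inner ℂ (h x) (u x) ∂μ) =
      fun u => inner ℂ (hh.toLp h) u := by
    funext u
    rw [L2.inner_def]
    refine integral_congr_ae ?_
    filter_upwards [hh.coeFn_toLp] with x hx
    rw [hx]
  rw [heq]
  fun_prop

end General

variable {d : ℕ} {Ω : Set (E d)}

section Gradient

lemma gradC_apply (w : E d → ℂ) (x : E d) (i : Fin d) :
    gradC w x i = fderiv ℝ w x (EuclideanSpace.single i 1) := rfl

lemma continuous_gradC {w : E d → ℂ} (hw : ContDiff ℝ ∞ w) : Continuous (gradC w) := by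
  have h := hw.continuous_fderiv (by simp)
  exact (PiLp.continuous_toLp 2 _).comp (continuous_pi fun i => by fun_prop)

lemma gradC_add {w₁ w₂ : E d → ℂ} (h₁ : ContDiff ℝ ∞ w₁) (h₂ : ContDiff ℝ ∞ w₂) (x : E d) :
    gradC (w₁ + w₂) x = gradC w₁ x + gradC w₂ x := by
  ext i
  simp only [gradC_apply, PiLp.add_apply]
  rw [fderiv_add (h₁.differentiable (by simp) x) (h₂.differentiable (by simp) x)]
  rfl

lemma gradC_const_smul {w : E d → ℂ} (hw : ContDiff ℝ ∞ w) (c : ℂ) (x : E d) :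
    gradC (c • w) x = c • gradC w x := by
  ext i
  simp only [gradC_apply, PiLp.smul_apply]
  rw [fderiv_const_smul (hw.differentiable (by simp) x)]
  rfl

lemma gradC_const (c : ℂ) (x : E d) : gradC (fun _ => c) x = 0 := by
  ext i
  simp [gradC_apply]

lemma norm_fderiv_le_norm_gradC (w : E d → ℂ) (x : E d) : ‖fderiv ℝ w x‖ ≤ ‖gradC w x‖ := by
  refine ContinuousLinearMap.opNorm_le_bound _ (norm_nonneg _) fun v => ?_
  have hv : fderiv ℝ w x v = ∑ i, v i • gradC w x i := by
    conv_lhs => rw [← (EuclideanSpace.basisFun (Fin d) ℝ).sum_repr v]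
    simp [gradC_apply]
  rw [hv, EuclideanSpace.norm_eq, EuclideanSpace.norm_eq, mul_comm]
  refine (norm_sum_le _ _).trans ?_
  simp only [norm_smul]
  exact Real.sum_mul_le_sqrt_mul_sqrt _ _ _

end Gradient

/-- The product of `L²(Ω)`, `L²(Ω)^d` and `L²(∂Ω)`. -/
abbrev TripleSpace (Ω : Set (E d)) : Type :=
  WithLp 2 (Lp ℂ 2 (volume.restrict Ω) ×
    WithLp 2 (Lp (EuclideanSpace ℂ (Fin d)) 2 (volume.restrict Ω) × BoundaryL2 Ω))

namespace TripleSpace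

/-- The components of `x` are `w`, its gradient, and its restriction to the boundary. -/
structure IsTriple (w : E d → ℂ) (x : TripleSpace Ω) : Prop where
  val : x.fst =ᵐ[volume.restrict Ω] w
  grad : x.snd.fst =ᵐ[volume.restrict Ω] gradC w
  trace : x.snd.snd =ᵐ[surfaceMeasure Ω] w

/-- The triples that come from smooth functions. -/
def smooth (Ω : Set (E d)) : Submodule ℂ (TripleSpace Ω) where
  carrier := {x | ∃ w, ContDiff ℝ ∞ w ∧ IsTriple w x}
  add_mem' := by
    rintro x y ⟨w, hw, hx⟩ ⟨w', hw', hy⟩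
    refine ⟨w + w', hw.add hw', ?_, ?_, ?_⟩
    · exact (Lp.coeFn_add _ _).trans (hx.val.add hy.val)
    · refine (Lp.coeFn_add _ _).trans ((hx.grad.add hy.grad).trans (ae_of_all _ fun z => ?_))
      exact (gradC_add hw hw' z).symm
    · exact (Lp.coeFn_add _ _).trans (hx.trace.add hy.trace)
  zero_mem' := by
    refine ⟨fun _ => 0, contDiff_const, Lp.coeFn_zero _ _ _, ?_, Lp.coeFn_zero _ _ _⟩
    exact (Lp.coeFn_zero _ _ _).trans (ae_of_all _ fun z => (gradC_const 0 z).symm)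
  smul_mem' := by
    rintro c x ⟨w, hw, hx⟩
    refine ⟨c • w, hw.const_smul c, ?_, ?_, ?_⟩
    · exact (Lp.coeFn_smul _ _).trans (hx.val.const_smul c)
    · refine (Lp.coeFn_smul _ _).trans ((hx.grad.const_smul c).trans (ae_of_all _ fun z => ?_))
      exact (gradC_const_smul hw c z).symm
    · exact (Lp.coeFn_smul _ _).trans (hx.trace.const_smul c)

/-- The closed subspace of all triples `(u, ∇u, g)` such that `g` is the trace of `u`. -/
def traced (Ω : Set (E d)) : Submodule ℂ (TripleSpace Ω) := (smooth Ω).topologicalClosure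

lemma isClosed_traced : IsClosed (traced Ω : Set (TripleSpace Ω)) :=
  (smooth Ω).isClosed_topologicalClosure

lemma smooth_le_traced : smooth Ω ≤ traced Ω := (smooth Ω).le_topologicalClosure

lemma memLp_of_continuous {F : Type*} [NormedAddCommGroup F] {f : E d → F} (hf : Continuous f)
    {K : Set (E d)} (hK : IsCompact K) {μ : Measure (E d)} [IsFiniteMeasure μ]
    (hμ : ∀ᵐ x ∂μ, x ∈ K) (p : ℝ≥0∞) : MemLp f p μ := by
  obtain ⟨C, hC⟩ := hK.exists_bound_of_continuousOn hf.continuousOn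
  exact MemLp.of_bound hf.aestronglyMeasurable C (hμ.mono hC)

section

variable (hΩ : IsBoundedLipschitzDomain Ω) (hd : 1 ≤ d)
include hΩ

lemma memLp_volume {F : Type*} [NormedAddCommGroup F] {f : E d → F} (hf : Continuous f) :
    MemLp f 2 (volume.restrict Ω) := by
  have : IsFiniteMeasure (volume.restrict Ω) := isFiniteMeasure_restrict.2 hΩ.volume_lt_top.ne
  exact memLp_of_continuous hf hΩ.isCompact_closure
    ((ae_restrict_mem hΩ.isOpen.measurableSet).mono fun x hx => subset_closure hx) 2

include hd

lemma memLp_surfaceMeasure {F : Type*} [NormedAddCommGroup F] {f : E d → F} (hf : Continuous f) :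
    MemLp f 2 (surfaceMeasure Ω) := by
  have := hΩ.isFiniteMeasure_surfaceMeasure hd
  exact memLp_of_continuous (μ := surfaceMeasure Ω) hf hΩ.isCompact_frontier
    (ae_restrict_mem isClosed_frontier.measurableSet) 2

lemma exists_isTriple {w : E d → ℂ} (hw : ContDiff ℝ ∞ w) : ∃ x : TripleSpace Ω, IsTriple w x :=
  ⟨WithLp.toLp 2 ((memLp_volume hΩ hw.continuous).toLp w,
    WithLp.toLp 2 ((memLp_volume hΩ (continuous_gradC hw)).toLp (gradC w),
      (memLp_surfaceMeasure hΩ hd hw.continuous).toLp w)),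
    (memLp_volume hΩ hw.continuous).coeFn_toLp,
    (memLp_volume hΩ (continuous_gradC hw)).coeFn_toLp,
    (memLp_surfaceMeasure hΩ hd hw.continuous).coeFn_toLp⟩

end

lemma tendsto_iff {x : ℕ → TripleSpace Ω} {y : TripleSpace Ω} :
    Tendsto x atTop (𝓝 y) ↔ Tendsto (fun k => (x k).fst) atTop (𝓝 y.fst) ∧
      Tendsto (fun k => (x k).snd.fst) atTop (𝓝 y.snd.fst) ∧
      Tendsto (fun k => (x k).snd.snd) atTop (𝓝 y.snd.snd) := by
  refine ⟨fun h => ⟨((WithLp.fstL 2 ℂ _ _).continuous.tendsto y).comp h,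
    ((WithLp.fstL 2 ℂ _ _ ∘L WithLp.sndL 2 ℂ _ _).continuous.tendsto y).comp h,
    ((WithLp.sndL 2 ℂ _ _ ∘L WithLp.sndL 2 ℂ _ _).continuous.tendsto y).comp h⟩,
    fun ⟨h1, h2, h3⟩ => ?_⟩
  have h23 : Tendsto (fun k => (x k).snd) atTop (𝓝 y.snd) :=
    ((WithLp.prod_continuous_toLp 2 _ _).tendsto (y.snd.fst, y.snd.snd)).comp
      (h2.prodMk_nhds h3)
  exact ((WithLp.prod_continuous_toLp 2 _ _).tendsto (y.fst, y.snd)).comp (h1.prodMk_nhds h23)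

lemma eLpNorm_congr_sub {α F : Type*} [MeasurableSpace α] {μ : Measure α} [NormedAddCommGroup F]
    {f g h : α → F} (hfg : f =ᵐ[μ] g) : eLpNorm (f - h) 2 μ = eLpNorm (fun x => g x - h x) 2 μ :=
  eLpNorm_congr_ae (hfg.sub (ae_eq_refl h))

/-- The triple of a function, its gradient and its trace. -/
def ofH1 (u : H1 Ω) (g : BoundaryL2 Ω) : TripleSpace Ω :=
  WithLp.toLp 2 (u.val, WithLp.toLp 2 (u.grad, g))

lemma ofH1_mem_traced (hΩ : IsBoundedLipschitzDomain Ω) (hd : 1 ≤ d) {u : H1 Ω}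
    {g : BoundaryL2 Ω} (h : u.HasTrace g) : ofH1 u g ∈ traced Ω := by
  obtain ⟨w, hw, h1, h2, h3⟩ := h
  choose x hx using fun k => exists_isTriple hΩ hd (hw k)
  refine mem_closure_of_tendsto (f := x) (b := atTop) (tendsto_iff.2 ⟨?_, ?_, ?_⟩)
    (Eventually.of_forall fun k => ⟨w k, hw k, hx k⟩)
  · rw [Lp.tendsto_Lp_iff_tendsto_eLpNorm']
    exact h1.congr fun k => (eLpNorm_congr_sub (hx k).val).symm
  · rw [Lp.tendsto_Lp_iff_tendsto_eLpNorm']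
    exact h2.congr fun k => (eLpNorm_congr_sub (hx k).grad).symm
  · rw [Lp.tendsto_Lp_iff_tendsto_eLpNorm']
    exact h3.congr fun k => (eLpNorm_congr_sub (hx k).trace).symm

lemma integral_mul_gradC_eq {w φ : E d → ℂ} (hw : ContDiff ℝ ∞ w) (hφ : ContDiff ℝ ∞ φ)
    (hc : HasCompactSupport φ) (hsupp : tsupport φ ⊆ Ω) (i : Fin d) :
    ∫ x in Ω, w x * gradC φ x i = - ∫ x in Ω, gradC w x i * φ x := by
  have hφ0 : ∀ x ∉ Ω, φ x = 0 := fun x hx => image_eq_zero_of_notMem_tsupport fun h => hx (hsupp h)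
  have hφ1 : ∀ x ∉ Ω, gradC φ x i = 0 := fun x hx => by
    rw [gradC_apply, fderiv_of_notMem_tsupport ℝ fun h => hx (hsupp h)]
    rfl
  rw [setIntegral_eq_integral_of_forall_compl_eq_zero fun x hx => by rw [hφ1 x hx, mul_zero],
    setIntegral_eq_integral_of_forall_compl_eq_zero fun x hx => by rw [hφ0 x hx, mul_zero]]
  have hwc := hw.continuous
  have hφc := hφ.continuous
  have hw' := hw.continuous_fderiv (by simp)
  have hφ' := hφ.continuous_fderiv (by simp)
  have hc' := hc.fderiv_apply (𝕜 := ℝ) (EuclideanSpace.single i (1 : ℝ))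
  refine integral_mul_fderiv_eq_neg_fderiv_mul_of_integrable ?_ ?_ ?_
    (fun x _ => hw.differentiable (by simp) x) (fun x _ => hφ.differentiable (by simp) x)
  · exact Continuous.integrable_of_hasCompactSupport (by fun_prop) hc.mul_left
  · exact Continuous.integrable_of_hasCompactSupport (by fun_prop) hc'.mul_left
  · exact Continuous.integrable_of_hasCompactSupport (by fun_prop) hc.mul_left

/-- For a fixed test function, the defining identity is a closed condition on the triple, and it
holds for smooth functions by integration by parts. -/
lemma isWeakGradient_of_mem_traced (hΩ : IsBoundedLipschitzDomain Ω) {x : TripleSpace Ω}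
    (hx : x ∈ traced Ω) : IsWeakGradient Ω x.fst x.snd.fst := by
  intro φ hφ hc hsupp i
  have h1 : Continuous fun x : TripleSpace Ω => ∫ z in Ω, x.fst z * gradC φ z i := by
    have hm : MemLp (fun z => starRingEnd ℂ (gradC φ z i)) 2 (volume.restrict Ω) :=
      memLp_volume hΩ (Complex.continuous_conj.comp
        ((EuclideanSpace.proj (𝕜 := ℂ) i).continuous.comp (continuous_gradC hφ)))
    refine ((continuous_integral_inner hm).comp (WithLp.fstL 2 ℂ _ _).continuous).congr fun x => ?_
    simp [WithLp.fstL]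
  have h2 : Continuous fun x : TripleSpace Ω => - ∫ z in Ω, x.snd.fst z i * φ z := by
    have hm : MemLp (fun z => EuclideanSpace.single i (starRingEnd ℂ (φ z))) 2
        (volume.restrict Ω) := by
      refine memLp_volume hΩ ?_
      have := hφ.continuous
      exact (PiLp.continuous_toLp 2 _).comp
        ((continuous_single (A := fun _ : Fin d => ℂ) i).comp (by fun_prop))
    refine (((continuous_integral_inner hm).comp
      (WithLp.fstL 2 ℂ _ _ ∘L WithLp.sndL 2 ℂ _ _).continuous).neg).congr fun x => ?_
    simp [WithLp.fstL, WithLp.sndL, EuclideanSpace.inner_single_left, mul_comm]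
  refine closure_minimal (t := {x : TripleSpace Ω |
    ∫ z in Ω, x.fst z * gradC φ z i = - ∫ z in Ω, x.snd.fst z i * φ z}) ?_
    (isClosed_eq h1 h2) hx
  rintro y ⟨w, hw, hy⟩
  change ∫ z in Ω, y.fst z * gradC φ z i = - ∫ z in Ω, y.snd.fst z i * φ z
  rw [integral_congr_ae (g := fun z => w z * gradC φ z i)
      (by filter_upwards [hy.val] with z hz; rw [hz]),
    integral_congr_ae (f := fun z => y.snd.fst z i * φ z) (g := fun z => gradC w z i * φ z)
      (by filter_upwards [hy.grad] with z hz; rw [hz])]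
  exact integral_mul_gradC_eq hw hφ hc hsupp i

/-- Converse of `ofH1_mem_traced`: together they turn statements about `H1` and `HasTrace` into
Hilbert space geometry in `traced`. -/
lemma exists_ofH1_eq (hΩ : IsBoundedLipschitzDomain Ω) {x : TripleSpace Ω} (hx : x ∈ traced Ω) :
    ∃ u : H1 Ω, u.HasTrace x.snd.snd ∧ ofH1 u x.snd.snd = x := by
  refine ⟨⟨x.fst, x.snd.fst, isWeakGradient_of_mem_traced hΩ hx⟩, ?_, rfl⟩
  obtain ⟨y, hy, hlim⟩ := mem_closure_iff_seq_limit.1 hx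
  choose w hw hyw using hy
  obtain ⟨h1, h2, h3⟩ := tendsto_iff.1 hlim
  rw [Lp.tendsto_Lp_iff_tendsto_eLpNorm'] at h1 h2 h3
  exact ⟨w, hw, h1.congr fun k => eLpNorm_congr_sub (hyw k).val,
    h2.congr fun k => eLpNorm_congr_sub (hyw k).grad,
    h3.congr fun k => eLpNorm_congr_sub (hyw k).trace⟩

end TripleSpace

end

/-! ### Multiplication by the conductivity, and coercivity on triples of mean zero -/

section

variable {d : ℕ} {Ω : Set (E d)}

section Coefficient

/-- The operator of multiplication by a coefficient. -/
def coeffOp (Ω : Set (E d)) : Linfty Ω →L[ℝ]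
    (Lp (EuclideanSpace ℂ (Fin d)) 2 (volume.restrict Ω) →L[ℂ]
      Lp (EuclideanSpace ℂ (Fin d)) 2 (volume.restrict Ω)) :=
  ((ContinuousLinearMap.holderL (volume.restrict Ω) ∞ 2 2
    (ContinuousLinearMap.lsmul ℂ ℂ)).restrictScalars ℝ).comp
    (ContinuousLinearMap.compLpL ∞ (volume.restrict Ω) Complex.ofRealCLM)

lemma coeFn_coeffOp (σ : Linfty Ω) (g : Lp (EuclideanSpace ℂ (Fin d)) 2 (volume.restrict Ω)) :
    coeffOp Ω σ g =ᵐ[volume.restrict Ω] fun x => (σ x : ℂ) • g x := by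
  have h1 := ContinuousLinearMap.coeFn_holder (r := 2) (ContinuousLinearMap.lsmul ℂ ℂ)
    (Complex.ofRealCLM.compLp σ) g
  filter_upwards [h1, ContinuousLinearMap.coeFn_compLp Complex.ofRealCLM σ] with x hx hx'
  refine hx.trans ?_
  rw [hx']
  rfl

lemma inner_coeffOp (σ : Linfty Ω) (g h : Lp (EuclideanSpace ℂ (Fin d)) 2 (volume.restrict Ω)) :
    inner ℂ h (coeffOp Ω σ g) = ∫ x in Ω, (σ x : ℂ) * inner ℂ (h x) (g x) := by
  rw [L2.inner_def]
  refine integral_congr_ae ?_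
  filter_upwards [coeFn_coeffOp σ g] with x hx
  rw [hx, inner_smul_right]

lemma inner_self_eq_ofReal {F : Type*} [NormedAddCommGroup F] [InnerProductSpace ℂ F] (g : F) :
    inner ℂ g g = ((‖g‖ ^ 2 : ℝ) : ℂ) := by
  rw [inner_self_eq_norm_sq_to_K]
  push_cast
  rfl

lemma isElliptic_coeffOp {σ : Linfty Ω} (hσ : σ ∈ LinftyPos Ω) : IsElliptic (coeffOp Ω σ) := by
  obtain ⟨a, ha, hle⟩ := hσ
  refine ⟨fun g h => ?_, a, ha, fun g => ?_⟩
  · rw [ContinuousLinearMap.coe_coe, inner_coeffOp, L2.inner_def]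
    refine integral_congr_ae ?_
    filter_upwards [coeFn_coeffOp σ g] with x hx
    rw [hx, inner_smul_left, Complex.conj_ofReal]
  · have h1 : a * ‖g‖ ^ 2 = (inner ℂ g ((a : ℂ) • g)).re := by
      rw [inner_smul_right, inner_self_eq_ofReal, Complex.re_ofReal_mul, Complex.ofReal_re]
    rw [h1, L2.inner_def, L2.inner_def]
    have hre : ∀ f : Lp (EuclideanSpace ℂ (Fin d)) 2 (volume.restrict Ω),
        (∫ x in Ω, inner ℂ (g x) (f x)).re = ∫ x in Ω, (inner ℂ (g x) (f x) : ℂ).re := fun f =>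
      (integral_re (L2.integrable_inner (𝕜 := ℂ) g f)).symm
    rw [hre, hre]
    refine integral_mono_ae (L2.integrable_inner (𝕜 := ℂ) g _).re
      (L2.integrable_inner (𝕜 := ℂ) g _).re ?_
    filter_upwards [coeFn_coeffOp σ g, Lp.coeFn_smul (a : ℂ) g, hle] with x hx hx' hax
    rw [hx, hx', Pi.smul_apply, inner_smul_right, inner_smul_right, inner_self_eq_ofReal,
      Complex.re_ofReal_mul, Complex.re_ofReal_mul, Complex.ofReal_re]
    gcongr

lemma ae_norm_le_norm {α F : Type*} [MeasurableSpace α] {μ : Measure α} [NormedAddCommGroup F]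
    (f : Lp F ∞ μ) : ∀ᵐ x ∂μ, ‖f x‖ ≤ ‖f‖ := by
  filter_upwards [ae_le_eLpNormEssSup (f := f) (μ := μ)] with x hx
  rwa [← eLpNorm_exponent_top, ← Lp.enorm_def, enorm_le_iff_norm_le] at hx

lemma isOpen_linftyPos : IsOpen (LinftyPos Ω) := by
  refine Metric.isOpen_iff.2 fun σ ⟨a, ha, hσ⟩ => ⟨a / 2, by positivity, fun τ hτ => ?_⟩
  refine ⟨a / 2, by positivity, ?_⟩
  rw [Metric.mem_ball, dist_eq_norm] at hτ
  filter_upwards [hσ, ae_norm_le_norm (τ - σ), Lp.coeFn_sub τ σ] with x hx hle hsub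
  rw [hsub, Pi.sub_apply, Real.norm_eq_abs] at hle
  have := (abs_le.1 (hle.trans hτ.le)).1
  linarith

end Coefficient

namespace TripleSpace

variable {e : TripleSpace Ω}

/-- The mean of the first component of a triple, where `e` is the triple of the constant `1`. -/
def mean (e : TripleSpace Ω) : TripleSpace Ω →L[ℂ] ℂ :=
  ((‖e.fst‖ ^ 2 : ℝ) : ℂ)⁻¹ • (innerSL ℂ e.fst ∘L WithLp.fstL 2 ℂ _ _)

/-- Subtraction of the mean. -/
def removeMean (e : TripleSpace Ω) : TripleSpace Ω →L[ℂ] TripleSpace Ω :=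
  ContinuousLinearMap.id ℂ _ - (mean e).smulRight e

lemma removeMean_apply (x : TripleSpace Ω) : removeMean e x = x - mean e x • e := by
  simp [removeMean]

lemma mean_self (he : e.fst ≠ 0) : mean e e = 1 := by
  have h : ((‖e.fst‖ ^ 2 : ℝ) : ℂ) ≠ 0 := by
    have := norm_pos_iff.2 he
    exact_mod_cast (by positivity : ‖e.fst‖ ^ 2 ≠ 0)
  have h2 : mean e e = ((‖e.fst‖ ^ 2 : ℝ) : ℂ)⁻¹ * inner ℂ e.fst e.fst := rfl
  rw [h2, inner_self_eq_norm_sq_to_K]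
  push_cast at h ⊢
  exact inv_mul_cancel₀ h

lemma removeMean_self (he : e.fst ≠ 0) : removeMean e e = 0 := by
  rw [removeMean_apply, mean_self he, one_smul, sub_self]

/-- The traced triples with mean zero. -/
def centered (e : TripleSpace Ω) : Submodule ℂ (TripleSpace Ω) :=
  traced Ω ⊓ LinearMap.ker (mean e : TripleSpace Ω →ₗ[ℂ] ℂ)

instance : CompleteSpace (centered e) := by
  have h : IsClosed (centered e : Set (TripleSpace Ω)) :=
    isClosed_traced.inter ((mean e).isClosed_ker)
  exact h.completeSpace_coe

lemma removeMean_eq_self {x : TripleSpace Ω} (hx : x ∈ centered e) : removeMean e x = x := by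
  have h : mean e x = 0 := hx.2
  rw [removeMean_apply, h, zero_smul, sub_zero]

lemma removeMean_mem_centered (he0 : e.fst ≠ 0) (he : e ∈ traced Ω) {x : TripleSpace Ω}
    (hx : x ∈ traced Ω) : removeMean e x ∈ centered e := by
  rw [removeMean_apply]
  refine ⟨Submodule.sub_mem _ hx (Submodule.smul_mem _ _ he), ?_⟩
  change mean e (x - mean e x • e) = 0
  rw [map_sub, map_smul, mean_self he0,
    smul_eq_mul, mul_one, sub_self]

lemma lintegral_fderiv_le {w : E d → ℂ} {x : TripleSpace Ω} (hx : IsTriple w x) :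
    ∫⁻ z in Ω, ‖fderiv ℝ w z‖ₑ ^ 2 ≤ ‖x.snd.fst‖ₑ ^ 2 := by
  rw [enorm_Lp_two_sq]
  refine lintegral_mono_ae ?_
  filter_upwards [hx.grad] with z hz
  rw [hz]
  gcongr
  rw [enorm_le_iff_norm_le]
  exact norm_fderiv_le_norm_gradC w z

section One

variable (he : IsTriple (fun _ => 1) e)
include he

lemma mem_traced_of_isTriple_one : e ∈ traced Ω :=
  smooth_le_traced ⟨_, contDiff_const, he⟩

lemma snd_fst_eq_zero : e.snd.fst = 0 := by
  refine Lp.ext (he.grad.trans (EventuallyEq.trans (ae_of_all _ fun x => ?_)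
    (Lp.coeFn_zero _ _ _).symm))
  exact gradC_const 1 x

lemma fst_ne_zero (hΩ : IsBoundedLipschitzDomain Ω) : e.fst ≠ 0 := fun h0 => by
  have h : ‖e.fst‖ₑ ^ 2 = volume Ω := by
    rw [enorm_Lp_two_sq, lintegral_congr_ae (g := fun _ => 1)
      (by filter_upwards [he.val] with x hx; rw [hx]; simp)]
    simp
  rw [h0] at h
  simp only [enorm_zero, ne_eq, OfNat.ofNat_ne_zero, not_false_eq_true, zero_pow] at h
  exact hΩ.volume_pos.ne h

lemma meanFree_eq : meanFree Ω = (Submodule.span ℂ {e.snd.snd})ᗮ := by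
  have h : {c : BoundaryL2 Ω | c =ᵐ[surfaceMeasure Ω] fun _ => (1 : ℂ)} = {e.snd.snd} := by
    ext c
    exact ⟨fun hc => Lp.ext (EventuallyEq.trans hc he.trace.symm), fun hc => by
      rw [Set.mem_singleton_iff.1 hc]; exact he.trace⟩
  rw [meanFree, h]

lemma removeMean_snd_fst (x : TripleSpace Ω) : (removeMean e x).snd.fst = x.snd.fst := by
  simp [removeMean_apply, snd_fst_eq_zero he]

lemma enorm_sub_fst_sq {w : E d → ℂ} {x : TripleSpace Ω} (hx : IsTriple w x) (c : ℂ) :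
    ‖(x - c • e).fst‖ₑ ^ 2 = ∫⁻ z in Ω, ‖w z - c‖ₑ ^ 2 := by
  rw [enorm_Lp_two_sq]
  refine lintegral_congr_ae ?_
  rw [WithLp.sub_fst, WithLp.smul_fst]
  filter_upwards [hx.val, he.val, Lp.coeFn_sub x.fst (c • e.fst), Lp.coeFn_smul c e.fst]
    with z h1 h2 h3 h4
  rw [h3, Pi.sub_apply, h4, Pi.smul_apply, h1, h2, smul_eq_mul, mul_one]

lemma enorm_sub_snd_snd_sq {w : E d → ℂ} {x : TripleSpace Ω} (hx : IsTriple w x) (c : ℂ) :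
    ‖(x - c • e).snd.snd‖ₑ ^ 2 = ∫⁻ z, ‖w z - c‖ₑ ^ 2 ∂(surfaceMeasure Ω) := by
  rw [enorm_Lp_two_sq]
  refine lintegral_congr_ae ?_
  rw [WithLp.sub_snd, WithLp.smul_snd, WithLp.sub_snd, WithLp.smul_snd]
  filter_upwards [hx.trace, he.trace, Lp.coeFn_sub x.snd.snd (c • e.snd.snd),
    Lp.coeFn_smul c e.snd.snd] with z h1 h2 h3 h4
  rw [h3, Pi.sub_apply, h4, Pi.smul_apply, h1, h2, smul_eq_mul, mul_one]

/-- The Poincaré and trace inequalities for smooth functions. -/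
lemma exists_norm_sub_smul_le (hΩ : IsBoundedLipschitzDomain Ω) (hd : 1 ≤ d) :
    ∃ C, 0 < C ∧ ∀ x ∈ smooth Ω, ∃ c : ℂ, ‖x - c • e‖ ≤ C * ‖x.snd.fst‖ := by
  obtain ⟨c, hc⟩ := hΩ.exists_controlled
  obtain ⟨A, hA⟩ := hc
  obtain ⟨B, hB⟩ := hΩ.controlled_surfaceMeasure hd ⟨A, hA⟩
  have aux : ∀ {F F' : Type _} [NormedAddCommGroup F] [NormedAddCommGroup F'] {f : F} {f' : F'}
      {C : ℝ≥0}, ‖f‖ₑ ^ 2 ≤ C * ‖f'‖ₑ ^ 2 → ‖f‖ ^ 2 ≤ C * ‖f'‖ ^ 2 := by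
    intro F F' _ _ f f' C h
    simp only [enorm_eq_nnnorm] at h
    have h' : ‖f‖₊ ^ 2 ≤ C * ‖f'‖₊ ^ 2 := by exact_mod_cast h
    exact_mod_cast h'
  -- The three summands bound the function, its gradient and its trace.
  refine ⟨Real.sqrt (A + 1 + B), by positivity, ?_⟩
  rintro x ⟨w, hw, hx⟩
  refine ⟨c w, ?_⟩
  have hw1 : ContDiff ℝ 1 w := hw.of_le (by simp)
  have h1 : ‖(x - c w • e).fst‖ ^ 2 ≤ A * ‖x.snd.fst‖ ^ 2 := aux <| by
    rw [enorm_sub_fst_sq he hx]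
    exact (hA w hw1).trans (mul_le_mul_right (lintegral_fderiv_le hx) _)
  have h2 : ‖(x - c w • e).snd.snd‖ ^ 2 ≤ B * ‖x.snd.fst‖ ^ 2 := aux <| by
    rw [enorm_sub_snd_snd_sq he hx]
    exact (hB w hw1).trans (mul_le_mul_right (lintegral_fderiv_le hx) _)
  have h3 : (x - c w • e).snd.fst = x.snd.fst := by simp [snd_fst_eq_zero he]
  refine abs_le_of_sq_le_sq' ?_ (by positivity) |>.2
  rw [WithLp.prod_norm_sq_eq_of_L2, WithLp.prod_norm_sq_eq_of_L2, h3, mul_pow,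
    Real.sq_sqrt (by positivity)]
  linarith

/-- The constant subtracted from a smooth triple is not known to depend continuously on it.
`removeMean` kills constants and is bounded, so the inequality can be rewritten with it and then
passes to the closure. -/
lemma exists_norm_removeMean_le (hΩ : IsBoundedLipschitzDomain Ω) (hd : 1 ≤ d) :
    ∃ C, 0 < C ∧ ∀ x ∈ traced Ω, ‖removeMean e x‖ ≤ C * ‖x.snd.fst‖ := by
  obtain ⟨C, hC, h⟩ := exists_norm_sub_smul_le he hΩ hd
  refine ⟨(‖removeMean e‖ + 1) * C, by positivity, fun x hx => ?_⟩
  have hcont : Continuous fun x : TripleSpace Ω => x.snd.fst :=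
    (WithLp.fstL 2 ℂ _ _ ∘L WithLp.sndL 2 ℂ _ _).continuous
  refine closure_minimal (t := {x : TripleSpace Ω |
    ‖removeMean e x‖ ≤ (‖removeMean e‖ + 1) * C * ‖x.snd.fst‖}) (fun x hx => ?_)
    (isClosed_le (by fun_prop) (by fun_prop)) hx
  obtain ⟨c, hc⟩ := h x hx
  have hQ : removeMean e x = removeMean e (x - c • e) := by
    rw [map_sub, map_smul, removeMean_self (fst_ne_zero he hΩ), smul_zero, sub_zero]
  change ‖removeMean e x‖ ≤ _
  rw [hQ, mul_assoc]
  refine ((removeMean e).le_opNorm _).trans ?_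
  gcongr
  linarith

end One

end TripleSpace

end

/-! ### Identification of the Neumann-to-Dirichlet operator -/

section

variable {d : ℕ} {Ω : Set (E d)}

instance : CompleteSpace (meanFree Ω) := by
  unfold meanFree
  infer_instance

/-- The orthogonal projection onto the mean-free functions. -/
def meanFreeProj (Ω : Set (E d)) : BoundaryL2 Ω →L[ℂ] L2diamond Ω :=
  (meanFree Ω).orthogonalProjectionOnto

lemma meanFreeProj_coe (f : L2diamond Ω) : meanFreeProj Ω f = f :=
  Submodule.orthogonalProjectionOnto_mem_subspace_eq_self f

lemma inner_meanFreeProj (h : BoundaryL2 Ω) (f : L2diamond Ω) :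
    inner ℂ (meanFreeProj Ω h) f = inner ℂ h (f : BoundaryL2 Ω) :=
  Submodule.inner_orthogonalProjectionOnto_eq_of_mem_right f h

namespace TripleSpace

/-- The gradient on the centered triples. -/
def gradL (e : TripleSpace Ω) :
    centered e →L[ℂ] Lp (EuclideanSpace ℂ (Fin d)) 2 (volume.restrict Ω) :=
  (WithLp.fstL 2 ℂ _ _ ∘L WithLp.sndL 2 ℂ _ _) ∘L (centered e).subtypeL

/-- The mean-free trace on the centered triples. -/
def traceL (e : TripleSpace Ω) : centered e →L[ℂ] L2diamond Ω :=
  meanFreeProj Ω ∘L (WithLp.sndL 2 ℂ _ _ ∘L WithLp.sndL 2 ℂ _ _) ∘L (centered e).subtypeL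

variable {e : TripleSpace Ω}

lemma traceL_apply (v : centered e) :
    traceL e v = meanFreeProj Ω (v : TripleSpace Ω).snd.snd := rfl

variable (hΩ : IsBoundedLipschitzDomain Ω) (hd : 1 ≤ d) (he : IsTriple (fun _ => 1) e)
include he

lemma meanFreeProj_one : meanFreeProj Ω e.snd.snd = 0 := by
  refine Submodule.orthogonalProjectionOnto_eq_zero_iff.2 ?_
  rw [meanFree_eq he]
  exact Submodule.le_orthogonal_orthogonal _ (Submodule.mem_span_singleton_self _)

lemma meanFreeProj_removeMean (x : TripleSpace Ω) :
    meanFreeProj Ω (removeMean e x).snd.snd = meanFreeProj Ω x.snd.snd := by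
  rw [removeMean_apply, WithLp.sub_snd, WithLp.smul_snd, WithLp.sub_snd, WithLp.smul_snd,
    map_sub, map_smul, meanFreeProj_one he, smul_zero, sub_zero]

lemma exists_meanFreeProj_eq (h : BoundaryL2 Ω) :
    ∃ c : ℂ, (meanFreeProj Ω h : BoundaryL2 Ω) = h - c • e.snd.snd := by
  have hmem : h - meanFreeProj Ω h ∈ (meanFree Ω)ᗮ :=
    Submodule.sub_starProjection_mem_orthogonal h
  have hO : (meanFree Ω)ᗮ = ℂ ∙ e.snd.snd := by
    rw [meanFree_eq he, Submodule.orthogonal_orthogonal]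
  rw [hO] at hmem
  obtain ⟨c, hc⟩ := Submodule.mem_span_singleton.1 hmem
  exact ⟨c, by rw [hc, sub_sub_cancel]⟩

include hΩ hd

lemma exists_mul_norm_le_norm_gradL : ∃ c : ℝ, 0 < c ∧ ∀ v, c * ‖v‖ ≤ ‖gradL e v‖ := by
  obtain ⟨C, hC, h⟩ := exists_norm_removeMean_le he hΩ hd
  refine ⟨C⁻¹, by positivity, fun v => ?_⟩
  have hv := h v v.2.1
  rw [removeMean_eq_self v.2] at hv
  rw [inv_mul_le_iff₀ hC]
  exact hv

/-- Smooth compactly supported functions are dense in `L²(∂Ω)`, the projection to mean-free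
functions is onto, and removing the interior mean does not change the projected trace. -/
lemma denseRange_traceL : DenseRange (traceL e) := by
  have := hΩ.isFiniteMeasure_surfaceMeasure hd
  have hsurj : Function.Surjective (meanFreeProj Ω) := fun f => ⟨f, meanFreeProj_coe f⟩
  refine (hsurj.denseRange.dense_image (meanFreeProj Ω).continuous
    (Lp.dense_hasCompactSupport_contDiff (F := ℂ) (μ := surfaceMeasure Ω) (p := 2)
      (by simp))).mono ?_
  rintro _ ⟨g, ⟨w, hgw, -, hw⟩, rfl⟩
  obtain ⟨x, hx⟩ := exists_isTriple hΩ hd hw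
  refine ⟨⟨removeMean e x, removeMean_mem_centered (fst_ne_zero he hΩ)
    (mem_traced_of_isTriple_one he) (smooth_le_traced ⟨w, hw, hx⟩)⟩, ?_⟩
  rw [traceL_apply, meanFreeProj_removeMean he]
  congr 1
  exact Lp.ext (hx.trace.trans hgw.symm)

lemma exists_mem_centered_inner_eq {σ : Linfty Ω} (hσ : σ ∈ LinftyPos Ω) (f : L2diamond Ω) :
    ∃ v : TripleSpace Ω, v ∈ centered e ∧
      solutionOp (V := centered e) (K := L2diamond Ω) (gradL e) (traceL e) (coeffOp Ω σ) f =
        meanFreeProj Ω v.snd.snd ∧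
      ∀ w ∈ centered e, inner ℂ w.snd.fst (coeffOp Ω σ v.snd.fst) =
        inner ℂ (meanFreeProj Ω w.snd.snd) f := by
  obtain ⟨c, hc, hgrad⟩ := exists_mul_norm_le_norm_gradL hΩ hd he
  have h : ∃ v : centered e,
      solutionOp (V := centered e) (K := L2diamond Ω) (gradL e) (traceL e) (coeffOp Ω σ) f =
        traceL e v ∧
      ∀ w, inner ℂ (gradL e w) (coeffOp Ω σ (gradL e v)) = inner ℂ (traceL e w) f := by
    refine IsElliptic.exists_solution (V := centered e) (K := L2diamond Ω)
      (grad := gradL e) (m := coeffOp Ω σ) (isElliptic_coeffOp hσ) hc ?_ (traceL e) f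
    exact fun v => hgrad v
  obtain ⟨v, hv, hs⟩ := h
  exact ⟨v, v.2, hv, fun w hw => hs ⟨w, hw⟩⟩

/-- Solutions of the variational problem on the centered triples are solutions of the Neumann
problem. -/
lemma isNeumannToDirichlet_of_forall_exists {σ : Linfty Ω} {T : L2diamond Ω →L[ℂ] L2diamond Ω}
    (hT : ∀ f, ∃ v ∈ centered e, T f = meanFreeProj Ω v.snd.snd ∧
      ∀ w ∈ centered e, inner ℂ w.snd.fst (coeffOp Ω σ v.snd.fst) =
        inner ℂ (meanFreeProj Ω w.snd.snd) f) :
    IsNeumannToDirichlet Ω σ T := by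
  have het := mem_traced_of_isTriple_one he
  have he0 := fst_ne_zero he hΩ
  intro f
  obtain ⟨v, hvc, hv, hsol⟩ := hT f
  -- `v` has mean zero in `Ω`, while the sought solution needs a mean-free trace; the two
  -- normalizations differ by a constant, which the gradient does not see.
  obtain ⟨k, hk⟩ := exists_meanFreeProj_eq he v.snd.snd
  have hx : v - k • e ∈ traced Ω := Submodule.sub_mem _ hvc.1 (Submodule.smul_mem _ _ het)
  obtain ⟨u, hut, hux⟩ := exists_ofH1_eq hΩ hx
  have hgu : u.grad = v.snd.fst := by
    have : u.grad = (v - k • e).snd.fst := congrArg (fun y : TripleSpace Ω => y.snd.fst) hux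
    rw [this]
    simp [snd_fst_eq_zero he]
  refine ⟨u, fun w h hw => ?_, ?_⟩
  -- A general test function may be centered: neither its gradient nor its pairing with the
  -- mean-free `f` changes.
  · have h1 := hsol _ (removeMean_mem_centered he0 het (ofH1_mem_traced hΩ hd hw))
    rw [← hgu, removeMean_snd_fst he, meanFreeProj_removeMean he, inner_coeffOp] at h1
    exact h1.trans (inner_meanFreeProj h f)
  · have ht : (T f : BoundaryL2 Ω) = (v - k • e).snd.snd :=
      (congrArg Subtype.val hv).trans hk
    rw [ht]
    exact hut

lemma isNeumannToDirichlet_solutionOp {σ : Linfty Ω} (hσ : σ ∈ LinftyPos Ω) :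
    IsNeumannToDirichlet Ω σ
      (solutionOp (V := centered e) (K := L2diamond Ω) (gradL e) (traceL e) (coeffOp Ω σ)) :=
  isNeumannToDirichlet_of_forall_exists hΩ hd he
    fun f => exists_mem_centered_inner_eq hΩ hd he hσ f

omit he in
-- Testing with the difference of two solutions shows that its gradient vanishes. By the Poincaré
-- inequality the difference is constant, and its trace is mean-free, hence zero.
lemma _root_.EIT.IsNeumannToDirichlet.unique {σ : Linfty Ω} (hσ : σ ∈ LinftyPos Ω)
    {T₁ T₂ : L2diamond Ω →L[ℂ] L2diamond Ω} (hT₁ : IsNeumannToDirichlet Ω σ T₁)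
    (hT₂ : IsNeumannToDirichlet Ω σ T₂) : T₁ = T₂ := by
  obtain ⟨e, he⟩ := exists_isTriple hΩ hd (w := fun _ => 1) contDiff_const
  have hell := isElliptic_coeffOp hσ
  ext1 f
  obtain ⟨u₁, hu₁, ht₁⟩ := hT₁ f
  obtain ⟨u₂, hu₂, ht₂⟩ := hT₂ f
  have hs : ∀ (w : H1 Ω) (h : BoundaryL2 Ω), w.HasTrace h →
      inner ℂ w.grad (coeffOp Ω σ (u₁.grad - u₂.grad)) = 0 := fun w h hw => by
    rw [map_sub, inner_sub_right, inner_coeffOp, inner_coeffOp, hu₁ w h hw, hu₂ w h hw, sub_self]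
  have hzero : u₁.grad - u₂.grad = 0 := by
    obtain ⟨a, ha, hb⟩ := hell.bound
    have h0 := hb (u₁.grad - u₂.grad)
    rw [inner_sub_left, hs _ _ ht₁, hs _ _ ht₂, sub_zero, Complex.zero_re] at h0
    have hn : ‖u₁.grad - u₂.grad‖ ^ 2 ≤ 0 := by
      by_contra hlt
      exact absurd h0 (not_le.2 (mul_pos ha (not_le.1 hlt)))
    exact norm_eq_zero.1 (pow_eq_zero_iff two_ne_zero |>.1 (le_antisymm hn (sq_nonneg _)))
  obtain ⟨C, hC, hle⟩ := exists_norm_removeMean_le he hΩ hd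
  set x := ofH1 u₁ (T₁ f : BoundaryL2 Ω) - ofH1 u₂ (T₂ f : BoundaryL2 Ω) with hx
  have hxt : x ∈ traced Ω :=
    Submodule.sub_mem _ (ofH1_mem_traced hΩ hd ht₁) (ofH1_mem_traced hΩ hd ht₂)
  have hxg : x.snd.fst = u₁.grad - u₂.grad := rfl
  have hQ : removeMean e x = 0 := by
    have := hle x hxt
    rw [hxg, hzero, norm_zero, mul_zero] at this
    exact norm_le_zero_iff.1 this
  have hP : meanFreeProj Ω x.snd.snd = 0 := by
    rw [← meanFreeProj_removeMean he, hQ, WithLp.zero_snd, WithLp.zero_snd, map_zero]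
  have hxs : x.snd.snd = ((T₁ f - T₂ f : L2diamond Ω) : BoundaryL2 Ω) := rfl
  rw [hxs, meanFreeProj_coe] at hP
  exact sub_eq_zero.1 hP

/-- The variational problem determines a unique Neumann-to-Dirichlet operator. -/
lemma isNeumannToDirichlet_iff {σ : Linfty Ω} (hσ : σ ∈ LinftyPos Ω)
    (T : L2diamond Ω →L[ℂ] L2diamond Ω) :
    IsNeumannToDirichlet Ω σ T ↔
      T = solutionOp (V := centered e) (K := L2diamond Ω) (gradL e) (traceL e) (coeffOp Ω σ) :=
  ⟨fun hT => hT.unique hΩ hd hσ (isNeumannToDirichlet_solutionOp hΩ hd he hσ),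
    fun hT => hT ▸ isNeumannToDirichlet_solutionOp hΩ hd he hσ⟩

lemma ntd_eq_solutionOp {σ : Linfty Ω} (hσ : σ ∈ LinftyPos Ω) :
    ntd Ω σ =
      solutionOp (V := centered e) (K := L2diamond Ω) (gradL e) (traceL e) (coeffOp Ω σ) := by
  have hex : ∃ T, IsNeumannToDirichlet Ω σ T :=
    ⟨_, (isNeumannToDirichlet_iff hΩ hd he hσ _).2 rfl⟩
  rw [ntd, dif_pos hex]
  exact (isNeumannToDirichlet_iff hΩ hd he hσ _).1 hex.choose_spec

end TripleSpace

section NeumannToDirichlet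

open TripleSpace

variable (hΩ : IsBoundedLipschitzDomain Ω) (hd : 1 ≤ d) {σ : Linfty Ω} (hσ : σ ∈ LinftyPos Ω)
include hΩ hd hσ

lemma isNeumannToDirichlet_iff_eq_ntd (T : L2diamond Ω →L[ℂ] L2diamond Ω) :
    IsNeumannToDirichlet Ω σ T ↔ T = ntd Ω σ := by
  obtain ⟨e, he⟩ := exists_isTriple hΩ hd (w := fun _ => 1) contDiff_const
  rw [isNeumannToDirichlet_iff hΩ hd he hσ, ntd_eq_solutionOp hΩ hd he hσ]

lemma differentiableAt_ntd : DifferentiableAt ℝ (ntd Ω) σ := by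
  obtain ⟨e, he⟩ := exists_isTriple hΩ hd (w := fun _ => 1) contDiff_const
  obtain ⟨c, hc, hgrad⟩ := exists_mul_norm_le_norm_gradL hΩ hd he
  have h : DifferentiableAt ℝ
      (fun σ => solutionOp (V := centered e) (K := L2diamond Ω) (gradL e) (traceL e)
        (coeffOp Ω σ)) σ :=
    differentiableAt_solutionOp (coeffOp Ω).differentiableAt
      ((isElliptic_coeffOp hσ).isUnit_formOp hc hgrad)
  -- `ntd` is identified with the solution operator on `LinftyPos Ω` only, which suffices because
  -- this set is open.
  refine h.congr_of_eventuallyEq ?_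
  filter_upwards [isOpen_linftyPos.mem_nhds hσ] with τ hτ
  exact ntd_eq_solutionOp hΩ hd he hτ

lemma exists_isSpectralRep_ntdFin {n : ℕ} {ψ : Fin n → L2diamond Ω} (hψ : Orthonormal ℂ ψ) :
    ∃ (μ : Fin n → ℝ) (φ : Fin n → L2diamond Ω), IsSpectralRep ψ (ntdFin Ω ψ σ) μ φ := by
  obtain ⟨e, he⟩ := exists_isTriple hΩ hd (w := fun _ => 1) contDiff_const
  obtain ⟨c, hc, hgrad⟩ := exists_mul_norm_le_norm_gradL hΩ hd he
  rw [ntdFin, ntd_eq_solutionOp hΩ hd he hσ]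
  exact (isElliptic_coeffOp hσ).exists_isSpectralRep_solutionOp (V := centered e)
    (K := L2diamond Ω) hψ hc hgrad (denseRange_traceL hΩ hd he)

lemma eventually_exists_isSpectralRep_ntdFin {n : ℕ} {ψ : Fin n → L2diamond Ω}
    (hψ : Orthonormal ℂ ψ) : ∀ᶠ τ in 𝓝 σ, ∃ μ φ, IsSpectralRep ψ (ntdFin Ω ψ τ) μ φ := by
  filter_upwards [isOpen_linftyPos.mem_nhds hσ] with τ hτ
  exact exists_isSpectralRep_ntdFin hΩ hd hτ hψ

end NeumannToDirichlet

end

end EIT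

end

theorem theorem1 {d : ℕ} (hd : 2 ≤ d) (Ω : Set (EIT.E d))
    (hΩ : EIT.IsBoundedLipschitzDomain Ω) (hΩc : IsConnected Ωᶜ)
    {n : ℕ} (ψ : Fin n → EIT.L2diamond Ω) (hψ : Orthonormal ℂ ψ)
    (σ : EIT.Linfty Ω) (hσ : σ ∈ EIT.LinftyPos Ω) :
    -- `Λ(σ)` is well defined as the Neumann-to-Dirichlet operator
    (∀ T, EIT.IsNeumannToDirichlet Ω σ T ↔ T = EIT.ntd Ω σ) ∧
    -- `Λ^(n)(σ)` has a positive eigensystem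
    (∃ (μ : Fin n → ℝ) (φ : Fin n → EIT.L2diamond Ω),
      EIT.IsSpectralRep ψ (EIT.ntdFin Ω ψ σ) μ φ) ∧
    -- Fréchet differentiability of `Λ` and of `log Λ^(n)` at `σ`
    DifferentiableAt ℝ (EIT.ntd Ω) σ ∧
    DifferentiableAt ℝ (EIT.logNtdFin Ω ψ) σ ∧
    -- for each choice of the eigensystem: the logarithm and its derivative
    ∀ (μ : Fin n → ℝ) (φ : Fin n → EIT.L2diamond Ω),
      EIT.IsSpectralRep ψ (EIT.ntdFin Ω ψ σ) μ φ →
      (∀ f : EIT.L2diamond Ω, EIT.logNtdFin Ω ψ σ f =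
        ∑ k, ((Real.log (μ k) : ℂ) * inner ℂ (φ k) f) • φ k) ∧
      ∀ (η : EIT.Linfty Ω) (f : EIT.L2diamond Ω),
        fderiv ℝ (EIT.logNtdFin Ω ψ) σ η f =
          ∑ j, ∑ k, ((EIT.logDivDiff (μ j) (μ k) : ℂ) * inner ℂ (φ k) f *
            inner ℂ (φ j) (fderiv ℝ (EIT.ntd Ω) σ η (φ k))) • φ j := by
  have hd1 : 1 ≤ d := by omega
  have hdiff := EIT.differentiableAt_ntd hΩ hd1 hσ
  have hex := EIT.eventually_exists_isSpectralRep_ntdFin hΩ hd1 hσ hψ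
  obtain ⟨μ₀, φ₀, h₀⟩ := EIT.exists_isSpectralRep_ntdFin hΩ hd1 hσ hψ
  refine ⟨EIT.isNeumannToDirichlet_iff_eq_ntd hΩ hd1 hσ, ⟨μ₀, φ₀, h₀⟩, hdiff,
    (h₀.hasFDerivAt_spectralLog_compression hψ hdiff.hasFDerivAt hex).differentiableAt,
    fun μ φ h => ⟨fun f => ?_, fun η f => ?_⟩⟩
  · rw [EIT.logNtdFin, h.spectralLog_eq hψ]
    exact EIT.spectralFun_apply _ f
  · exact h.fderiv_spectralLog_compression hψ hdiff hex η f
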